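/- Let $k$ be a commutative artinian ring, $A$ an Artin $k$-algebra (a $k$-algebra that is finitely generated as a $k$-module), and $\mathrm{mod}\,A$ the category of left $A$-modules of finite length (equivalently, finitely generated ones). An exact structure $\mathcal E$ on $\mathrm{mod}\,A$ is a collection, closed under isomorphism, of kernel-cokernel pairs $X\xrightarrow{f}Y\xrightarrow{g}Z$ such that, calling the morphisms $f$ (resp. $g$) occurring in members $(f,g)$ of $\mathcal E$ the $\mathcal E$-monomorphisms (resp. $\mathcal E$-epimorphisms): all identities are $\mathcal E$-monomorphisms and $\mathcal E$-epimorphisms; both classes are closed under composition; the pushout of an $\mathcal E$-monomorphism along any morphism exists and is an $\mathcal E$-monomorphism; the pullback of an $\mathcal E$-epimorphism along any morphism exists and is an $\mathcal E$-epimorphism. An ideal of $\mathrm{mod}\,A$ is a class $\mathcal I$ of morphisms containing all zero morphisms and closed under sums of parallel morphisms and under composition with arbitrary morphisms on either side. Let $\mathrm{fp}(\mathrm{mod}\,A,\mathrm{Ab})$ be the abelian category of functors isomorphic to $\mathrm{coker}\,\mathrm{Hom}_A(f,-)$ for a morphism $f$ in $\mathrm{mod}\,A$. An ideal $\mathcal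 I$ is fp-idempotent if $$\mathcal S_{\mathcal I}=\{F\in \mathrm{fp}(\mathrm{mod}\,A,\mathrm{Ab})\mid F(\varphi)=0 \text{ for all }\varphi\in\mathcal I\}$$ is a Serre subcategory of $\mathrm{fp}(\mathrm{mod}\,A,\mathrm{Ab})$, that is, closed under subobjects, quotients and extensions. For an exact structure $\mathcal E$ let $\mathcal I_{\mathcal E}$ (the $\mathcal E$-injectivity ideal) consist of all $f\colon X\to Y$ such that for every $\mathcal E$-monomorphism $m\colon X\to M$ there is $g\colon M\to Y$ with $gm=f$, and let $\mathcal P_{\mathcal E}$ (the $\mathcal E$-projectivity ideal) consist of all $f\colon X\to Y$ such that for every $\mathcal E$-epimorphism $p\colon M\to Y$ there is $g\colon X\to M$ with $pg=f$. Then the assignment $\mathcal E\mapsto\mathcal I_{\mathcal E}$ is a bijection from the exact structures on $\mathrm{mod}\,A$ to the fp-idempotent ideals $\mathcal I$ of $\mathrm{mod}\,A$ containing all morphisms that factor through an injective module in $\mathrm{mod}\,A$, with inverse $$\mathcal I\mapsto\mathcal E_{\mathcal I}=\{(f,\mathrm{coker}\,f)\mid \mathrm{coker}\,\mathrm{Hom}_A(f,-)(\varphi)=0\text{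 for all }\varphi\in\mathcal I\};$$ and the assignment $\mathcal E\mapsto\mathcal P_{\mathcal E}$ is a bijection from the exact structures on $\mathrm{mod}\,A$ to the fp-idempotent ideals $\mathcal P$ of $\mathrm{mod}\,A$ containing all morphisms that factor through a projective module in $\mathrm{mod}\,A$, with inverse $$\mathcal P\mapsto\mathcal E_{\mathcal P}=\{(\ker g,g)\mid \mathrm{coker}\,\mathrm{Hom}_A(-,g)(\psi)=0\text{ for all }\psi\in\mathcal P\}.$$ Consequently the three collections are in one-to-one correspondence. (In $\mathcal E_{\mathcal I}$ and $\mathcal E_{\mathcal P}$ all choices of cokernels and kernels are included.) -/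

import Mathlib

open CategoryTheory CategoryTheory.Limits

universe u w

/-! ### Exact structures -/

section ExactStructures

variable {C : Type*} [Category C] [Preadditive C]

/-- A sequence `X ⟶ Y ⟶ Z` is a kernel-cokernel pair if the first map is a kernel of the second
and the second map is a cokernel of the first. -/
structure IsKernelCokernelPair (S : ShortComplex C) : Prop where
  isKernel : Nonempty (IsLimit (KernelFork.ofι S.f S.zero))
  isCokernel : Nonempty (IsColimit (CokernelCofork.ofπ S.g S.zero))

/-- `f` is an `E`-monomorphism, for a class `E` of sequences: `f` is the first map of a member. -/
def IsMonoOf (E : ObjectProperty (ShortComplex C)) {X Y : C} (f : X ⟶ Y) : Prop :=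
  ∃ (Z : C) (g : Y ⟶ Z) (h : f ≫ g = 0), E (ShortComplex.mk f g h)

/-- `g` is an `E`-epimorphism, for a class `E` of sequences: `g` is the second map of a member. -/
def IsEpiOf (E : ObjectProperty (ShortComplex C)) {Y Z : C} (g : Y ⟶ Z) : Prop :=
  ∃ (X : C) (f : X ⟶ Y) (h : f ≫ g = 0), E (ShortComplex.mk f g h)

variable (C) in
/-- An exact structure (Quillen, in Bühler's formulation): an isomorphism-closed class of
kernel-cokernel pairs satisfying the axioms E0, E1, E2 and their duals. -/
@[ext]
structure ExactStructure where
  /-- the exact sequences of the structure -/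
  exact : ObjectProperty (ShortComplex C)
  isKernelCokernelPair : ∀ S : ShortComplex C, exact S → IsKernelCokernelPair S
  of_iso : ∀ {S T : ShortComplex C}, (S ≅ T) → exact S → exact T
  mono_id : ∀ X : C, IsMonoOf exact (𝟙 X)
  epi_id : ∀ X : C, IsEpiOf exact (𝟙 X)
  mono_comp : ∀ {X Y Z : C} (f : X ⟶ Y) (g : Y ⟶ Z),
    IsMonoOf exact f → IsMonoOf exact g → IsMonoOf exact (f ≫ g)
  epi_comp : ∀ {X Y Z : C} (f : X ⟶ Y) (g : Y ⟶ Z),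
    IsEpiOf exact f → IsEpiOf exact g → IsEpiOf exact (f ≫ g)
  mono_pushout : ∀ {X Y X' : C} (f : X ⟶ Y) (a : X ⟶ X'), IsMonoOf exact f →
    ∃ (Y' : C) (b : Y ⟶ Y') (f' : X' ⟶ Y'), IsPushout f a b f' ∧ IsMonoOf exact f'
  epi_pullback : ∀ {Y Z Z' : C} (g : Y ⟶ Z) (a : Z' ⟶ Z), IsEpiOf exact g →
    ∃ (Y' : C) (g' : Y' ⟶ Z') (b : Y' ⟶ Y), IsPullback b g' g a ∧ IsEpiOf exact g'

end ExactStructures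

/-! ### Ideals of morphisms -/

section Ideals

variable {C : Type*} [Category C] [Preadditive C]

variable (C) in
/-- An ideal of morphisms of a preadditive category. -/
@[ext]
structure MorphismIdeal where
  /-- the morphisms belonging to the ideal -/
  mem : MorphismProperty C
  zero_mem : ∀ X Y : C, mem (0 : X ⟶ Y)
  add_mem : ∀ {X Y : C} (f g : X ⟶ Y), mem f → mem g → mem (f + g)
  comp_mem : ∀ {X' X Y Y' : C} (a : X' ⟶ X) (f : X ⟶ Y) (b : Y ⟶ Y'), mem f → mem (a ≫ f ≫ b)

/-- The `E`-injectivity ideal: all `f : X ⟶ Y` that extend along every `E`-monomorphism starting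
in `X`. -/
def ExactStructure.injectivityIdeal (E : ExactStructure C) : MorphismIdeal C where
  mem := fun X Y f => ∀ (M : C) (m : X ⟶ M), IsMonoOf E.exact m → ∃ g : M ⟶ Y, m ≫ g = f
  zero_mem := fun _ _ _ _ _ => ⟨0, comp_zero⟩
  add_mem := fun f g hf hg M m hm => by
    obtain ⟨p, hp⟩ := hf M m hm
    obtain ⟨q, hq⟩ := hg M m hm
    exact ⟨p + q, by rw [Preadditive.comp_add, hp, hq]⟩
  comp_mem := fun a f b hf M m hm => by
    obtain ⟨P, i, m', hP, hm'⟩ := E.mono_pushout m a hm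
    obtain ⟨p, hp⟩ := hf P m' hm'
    exact ⟨i ≫ p ≫ b, by rw [← hp, ← Category.assoc, hP.w]; simp⟩

/-- The `E`-projectivity ideal: all `f : X ⟶ Y` that lift along every `E`-epimorphism ending
in `Y`. -/
def ExactStructure.projectivityIdeal (E : ExactStructure C) : MorphismIdeal C where
  mem := fun X Y f => ∀ (M : C) (p : M ⟶ Y), IsEpiOf E.exact p → ∃ g : X ⟶ M, g ≫ p = f
  zero_mem := fun _ _ _ _ _ => ⟨0, zero_comp⟩
  add_mem := fun f g hf hg M m hm => by
    obtain ⟨p, hp⟩ := hf M m hm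
    obtain ⟨q, hq⟩ := hg M m hm
    exact ⟨p + q, by rw [Preadditive.add_comp, hp, hq]⟩
  comp_mem := fun a f b hf M m hm => by
    obtain ⟨P, m', i, hP, hm'⟩ := E.epi_pullback m b hm
    obtain ⟨p, hp⟩ := hf P m' hm'
    exact ⟨a ≫ p ≫ i, by rw [← hp, Category.assoc, Category.assoc, hP.w]; simp⟩

end Ideals

/-! ### Finitely presented functors, Serre subcategories, fp-idempotent ideals -/

noncomputable section FpFunctors

variable {C : Type*} [Category.{u} C] [Preadditive C]

/-- The functor `coker Hom(f, -) : C ⥤ Ab`. -/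
def cokerHom {X Y : C} (f : X ⟶ Y) : C ⥤ AddCommGrpCat.{u} :=
  cokernel (preadditiveCoyoneda.map f.op)

/-- The functor `coker Hom(-, g) : Cᵒᵖ ⥤ Ab`. -/
def cokerHomOp {Y Z : C} (g : Y ⟶ Z) : Cᵒᵖ ⥤ AddCommGrpCat.{u} :=
  cokernel (preadditiveYoneda.map g)

/-- Finitely presented functors `C ⥤ Ab`; these are automatically additive. -/
def IsFpFunctor : ObjectProperty (C ⥤ AddCommGrpCat.{u}) :=
  fun F => ∃ (X Y : C) (f : X ⟶ Y), Nonempty (F ≅ cokerHom f)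

/-- `S` is a Serre subcategory of the category `fp(C, Ab)` of finitely presented functors.
Exactness of a sequence of functors means exactness at every object; when `C` has weak cokernels
`fp(C, Ab)` is closed under kernels and cokernels of functors, so this is exactness
in `fp(C, Ab)`. -/
structure IsSerreInFp (S : ObjectProperty (C ⥤ AddCommGrpCat.{u})) : Prop where
  le_fp : ∀ F, S F → IsFpFunctor F
  zero : ∀ F : C ⥤ AddCommGrpCat.{u}, IsZero F → S F
  iff_of_shortExact : ∀ T : ShortComplex (C ⥤ AddCommGrpCat.{u}), T.ShortExact →
    IsFpFunctor T.X₁ → IsFpFunctor T.X₂ → IsFpFunctor T.X₃ → (S T.X₂ ↔ S T.X₁ ∧ S T.X₃)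

namespace MorphismIdeal

/-- The finitely presented functors that vanish on all morphisms of the ideal `I`. -/
def annihilator (I : MorphismIdeal C) : ObjectProperty (C ⥤ AddCommGrpCat.{u}) :=
  fun F => IsFpFunctor F ∧ ∀ ⦃X Y : C⦄ (φ : X ⟶ Y), I.mem φ → F.map φ = 0

/-- `I` is fp-idempotent: the finitely presented functors vanishing on `I` form a Serre
subcategory. -/
def IsFpIdempotent (I : MorphismIdeal C) : Prop :=
  IsSerreInFp I.annihilator

/-- The sequences `(f, coker f)` such that `coker Hom(f, -)` vanishes on `I`. -/
def leftExact (I : MorphismIdeal C) : ObjectProperty (ShortComplex C) :=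
  fun S => Nonempty (IsColimit (CokernelCofork.ofπ S.g S.zero)) ∧
    ∀ ⦃U V : C⦄ (φ : U ⟶ V), I.mem φ → (cokerHom S.f).map φ = 0

/-- The sequences `(ker g, g)` such that `coker Hom(-, g)` vanishes on `P`. -/
def rightExact (P : MorphismIdeal C) : ObjectProperty (ShortComplex C) :=
  fun S => Nonempty (IsLimit (KernelFork.ofι S.f S.zero)) ∧
    ∀ ⦃U V : C⦄ (ψ : U ⟶ V), P.mem ψ → (cokerHomOp S.g).map ψ.op = 0

end MorphismIdeal

end FpFunctors

/-! ### Modules over an Artin algebra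

The category `mod A` is `FGModuleCat A`; over an Artin algebra the finitely generated modules are
exactly those of finite length. -/

section ArtinAlgebra

theorem finite_iff_isFiniteLength (k : Type w) (A : Type u) [CommRing k] [IsArtinianRing k]
    [Ring A] [Algebra k A] [Module.Finite k A] (M : Type u) [AddCommGroup M] [Module A M] :
    Module.Finite A M ↔ IsFiniteLength A M := by
  have : IsArtinianRing A := IsArtinianRing.of_finite k A
  exact (IsArtinianRing.tfae A M).out 0 3

variable {A : Type u} [Ring A]

/-- The ideal contains all morphisms of `mod A` that factor through an injective module. -/
def MorphismIdeal.ContainsInjectives (I : MorphismIdeal (FGModuleCat.{u} A)) : Prop :=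
  ∀ (X Q Y : FGModuleCat.{u} A) (a : X ⟶ Q) (b : Q ⟶ Y), Module.Injective A Q → I.mem (a ≫ b)

/-- The ideal contains all morphisms of `mod A` that factor through a projective module. -/
def MorphismIdeal.ContainsProjectives (I : MorphismIdeal (FGModuleCat.{u} A)) : Prop :=
  ∀ (X Q Y : FGModuleCat.{u} A) (a : X ⟶ Q) (b : Q ⟶ Y), Module.Projective A Q → I.mem (a ≫ b)

end ArtinAlgebra

/-! The functor `coker Hom(f, -)` vanishes on an ideal `I` exactly when every member of `I` with the
source of `f` factors through `f` (`ExtendsAlong`). So the admissible monomorphisms of an exact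
structure are to be matched with the morphisms along which an ideal extends. In this language only
extension-closure of the annihilator has content, and it becomes the elementary condition
`IsSaturated`; containing the injectives becomes `HasMonos`, which forces the morphisms along which
`I` extends to be monic.

From ideals to exact structures the argument is formal, saturation giving closure under composition.
In the other direction, the obscure axiom makes an injectivity ideal saturated once it is known to
determine its exact structure. That the two constructions are mutually inverse rests on a duality `D
= Hom(-, E)`. In `isMonoOf_of_extendsAlong`, a functional detecting a non-admissible extension is,
by Auslander-Reiten duality, a morphism into the translate of its cokernel; it lies in the ideal but
does not extend. In `mem_of_forall_extendsAlong`, a functional separating a morphism from `I` yields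
a morphism along which `I` extends and the given one does not.

The projective half is the injective half for the opposite category. The hypotheses in `IsDualizing`
are self-dual, and saturation is self-dual by `IsSaturated.op`, the trace of the duality between
covariant and contravariant finitely presented functors. For modules all the duality comes from the
Nakayama pairs `(Aⁿ, D(Aⁿ))`, with `E` a Matlis cogenerator over the centre of `A`. -/

/-! ### Opposite exact structures and opposite ideals. -/

section Opposites

open Opposite

variable {C : Type*} [Category C] [Preadditive C]

theorem IsKernelCokernelPair.op {S : ShortComplex C} (h : IsKernelCokernelPair S) :
    IsKernelCokernelPair S.op :=
  ⟨h.isCokernel.map (CokernelCofork.IsColimit.ofπOp _ S.zero),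
    h.isKernel.map (KernelFork.IsLimit.ofιOp _ S.zero)⟩

theorem IsKernelCokernelPair.unop {S : ShortComplex Cᵒᵖ} (h : IsKernelCokernelPair S) :
    IsKernelCokernelPair S.unop :=
  ⟨h.isCokernel.map (CokernelCofork.IsColimit.ofπUnop _ S.zero),
    h.isKernel.map (KernelFork.IsLimit.ofιUnop _ S.zero)⟩

theorem isMonoOf_unop_iff {E : ObjectProperty (ShortComplex C)} {X Y : Cᵒᵖ} (f : X ⟶ Y) :
    IsMonoOf (fun S : ShortComplex Cᵒᵖ => E S.unop) f ↔ IsEpiOf E f.unop :=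
  ⟨fun ⟨Z, g, h, hE⟩ => ⟨Z.unop, g.unop, Quiver.Hom.op_inj h, hE⟩,
    fun ⟨Z, g, h, hE⟩ => ⟨op Z, g.op, Quiver.Hom.unop_inj h, hE⟩⟩

theorem isEpiOf_unop_iff {E : ObjectProperty (ShortComplex C)} {X Y : Cᵒᵖ} (f : X ⟶ Y) :
    IsEpiOf (fun S : ShortComplex Cᵒᵖ => E S.unop) f ↔ IsMonoOf E f.unop :=
  ⟨fun ⟨Z, g, h, hE⟩ => ⟨Z.unop, g.unop, Quiver.Hom.op_inj h, hE⟩,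
    fun ⟨Z, g, h, hE⟩ => ⟨op Z, g.op, Quiver.Hom.unop_inj h, hE⟩⟩

theorem isMonoOf_op_iff {E : ObjectProperty (ShortComplex Cᵒᵖ)} {X Y : C} (f : X ⟶ Y) :
    IsMonoOf (fun S : ShortComplex C => E S.op) f ↔ IsEpiOf E f.op :=
  ⟨fun ⟨Z, g, h, hE⟩ => ⟨op Z, g.op, Quiver.Hom.unop_inj h, hE⟩,
    fun ⟨Z, g, h, hE⟩ => ⟨Z.unop, g.unop, Quiver.Hom.op_inj h, hE⟩⟩

theorem isEpiOf_op_iff {E : ObjectProperty (ShortComplex Cᵒᵖ)} {X Y : C} (f : X ⟶ Y) :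
    IsEpiOf (fun S : ShortComplex C => E S.op) f ↔ IsMonoOf E f.op :=
  ⟨fun ⟨Z, g, h, hE⟩ => ⟨op Z, g.op, Quiver.Hom.unop_inj h, hE⟩,
    fun ⟨Z, g, h, hE⟩ => ⟨Z.unop, g.unop, Quiver.Hom.op_inj h, hE⟩⟩

namespace ExactStructure

/-- The opposite of an exact structure. -/
def op (E : ExactStructure C) : ExactStructure Cᵒᵖ where
  exact := fun S => E.exact S.unop
  isKernelCokernelPair S hS := (E.isKernelCokernelPair _ hS).op
  of_iso e hS := E.of_iso ((ShortComplex.opEquiv C).inverse.mapIso e).unop.symm hS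
  mono_id X := (isMonoOf_unop_iff _).2 (E.epi_id X.unop)
  epi_id X := (isEpiOf_unop_iff _).2 (E.mono_id X.unop)
  mono_comp f g hf hg := (isMonoOf_unop_iff _).2
    (E.epi_comp _ _ ((isMonoOf_unop_iff _).1 hg) ((isMonoOf_unop_iff _).1 hf))
  epi_comp f g hf hg := (isEpiOf_unop_iff _).2
    (E.mono_comp _ _ ((isEpiOf_unop_iff _).1 hg) ((isEpiOf_unop_iff _).1 hf))
  mono_pushout f a hf := by
    obtain ⟨Y', g', b, h, hg⟩ := E.epi_pullback f.unop a.unop ((isMonoOf_unop_iff _).1 hf)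
    exact ⟨.op Y', b.op, g'.op, h.op.flip, (isMonoOf_unop_iff _).2 hg⟩
  epi_pullback f a hf := by
    obtain ⟨Y', b, g', h, hg⟩ := E.mono_pushout f.unop a.unop ((isEpiOf_unop_iff _).1 hf)
    exact ⟨.op Y', g'.op, b.op, h.op.flip, (isEpiOf_unop_iff _).2 hg⟩

/-- The exact structure on `C` defined by an exact structure on `Cᵒᵖ`. -/
def unop (E : ExactStructure Cᵒᵖ) : ExactStructure C where
  exact := fun S => E.exact S.op
  isKernelCokernelPair S hS := (E.isKernelCokernelPair _ hS).unop
  of_iso e hS := E.of_iso ((ShortComplex.opEquiv C).functor.mapIso e.op).symm hS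
  mono_id X := (isMonoOf_op_iff _).2 (E.epi_id (.op X))
  epi_id X := (isEpiOf_op_iff _).2 (E.mono_id (.op X))
  mono_comp f g hf hg := (isMonoOf_op_iff _).2
    (E.epi_comp _ _ ((isMonoOf_op_iff _).1 hg) ((isMonoOf_op_iff _).1 hf))
  epi_comp f g hf hg := (isEpiOf_op_iff _).2
    (E.mono_comp _ _ ((isEpiOf_op_iff _).1 hg) ((isEpiOf_op_iff _).1 hf))
  mono_pushout f a hf := by
    obtain ⟨Y', g', b, h, hg⟩ := E.epi_pullback f.op a.op ((isMonoOf_op_iff _).1 hf)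
    exact ⟨Y'.unop, b.unop, g'.unop, h.unop.flip, (isMonoOf_op_iff _).2 hg⟩
  epi_pullback f a hf := by
    obtain ⟨Y', b, g', h, hg⟩ := E.mono_pushout f.op a.op ((isEpiOf_op_iff _).1 hf)
    exact ⟨Y'.unop, g'.unop, b.unop, h.unop.flip, (isEpiOf_op_iff _).2 hg⟩

variable (C) in
/-- Exact structures on `C` are the same as exact structures on `Cᵒᵖ`. -/
def opEquiv : ExactStructure C ≃ ExactStructure Cᵒᵖ where
  toFun := op
  invFun := unop
  left_inv _ := rfl
  right_inv _ := rfl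

theorem isMonoOf_op {E : ExactStructure C} {X Y : Cᵒᵖ} (f : X ⟶ Y) :
    IsMonoOf E.op.exact f ↔ IsEpiOf E.exact f.unop := isMonoOf_unop_iff f

theorem isEpiOf_op {E : ExactStructure C} {X Y : Cᵒᵖ} (f : X ⟶ Y) :
    IsEpiOf E.op.exact f ↔ IsMonoOf E.exact f.unop := isEpiOf_unop_iff f

end ExactStructure

namespace MorphismIdeal

/-- The opposite of an ideal. -/
def op (I : MorphismIdeal C) : MorphismIdeal Cᵒᵖ where
  mem := fun _ _ f => I.mem f.unop
  zero_mem X Y := I.zero_mem _ _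
  add_mem _ _ hf hg := I.add_mem _ _ hf hg
  comp_mem a f b hf := by
    simpa using I.comp_mem b.unop f.unop a.unop hf

/-- The ideal of `C` defined by an ideal of `Cᵒᵖ`. -/
def unop (I : MorphismIdeal Cᵒᵖ) : MorphismIdeal C where
  mem := fun _ _ f => I.mem f.op
  zero_mem X Y := I.zero_mem _ _
  add_mem _ _ hf hg := I.add_mem _ _ hf hg
  comp_mem a f b hf := by
    simpa using I.comp_mem b.op f.op a.op hf

variable (C) in
/-- Ideals of `C` are the same as ideals of `Cᵒᵖ`. -/
def opEquiv : MorphismIdeal C ≃ MorphismIdeal Cᵒᵖ where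
  toFun := op
  invFun := unop
  left_inv _ := rfl
  right_inv _ := rfl

end MorphismIdeal

theorem ExactStructure.injectivityIdeal_op (E : ExactStructure C) :
    E.op.injectivityIdeal = E.projectivityIdeal.op := by
  ext X Y f
  constructor
  · intro h M p hp
    obtain ⟨g, hg⟩ := h (.op M) p.op ((isMonoOf_op _).2 hp)
    exact ⟨g.unop, Quiver.Hom.op_inj hg⟩
  · intro h M m hm
    obtain ⟨g, hg⟩ := h M.unop m.unop ((isMonoOf_op _).1 hm)
    exact ⟨g.op, Quiver.Hom.unop_inj hg⟩

end Opposites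

/-! ### Ideals described by factorizations of morphisms. -/

namespace MorphismIdeal

variable {C : Type*} [Category C] [Preadditive C] (I : MorphismIdeal C)

theorem comp_left_mem {X' X Y : C} (a : X' ⟶ X) {f : X ⟶ Y} (hf : I.mem f) : I.mem (a ≫ f) := by
  simpa using I.comp_mem a f (𝟙 Y) hf

theorem comp_right_mem {X Y Y' : C} {f : X ⟶ Y} (b : Y ⟶ Y') (hf : I.mem f) : I.mem (f ≫ b) := by
  simpa using I.comp_mem (𝟙 X) f b hf

/-- All morphisms in the ideal `I` with the same source as `f` factor through `f`. -/
def ExtendsAlong {X Y : C} (f : X ⟶ Y) : Prop :=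
  ∀ ⦃V : C⦄ (φ : X ⟶ V), I.mem φ → ∃ h : Y ⟶ V, f ≫ h = φ

/-- All morphisms in the ideal `I` with the same target as `g` factor through `g`. -/
def LiftsAlong {Y Z : C} (g : Y ⟶ Z) : Prop :=
  ∀ ⦃U : C⦄ (ψ : U ⟶ Z), I.mem ψ → ∃ h : U ⟶ Y, h ≫ g = ψ

/-- The condition on an ideal `I` which expresses that the finitely presented functors vanishing
on `I` are closed under extensions: the functor `coker Hom(f, -)` is an extension of the quotient
`coker Hom((f, s), -)` by the subfunctor generated by `s`. -/
def IsSaturated : Prop :=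
  ∀ ⦃X Y W : C⦄ (f : X ⟶ Y) (s : X ⟶ W),
    (∀ ⦃V : C⦄ (φ : W ⟶ V), I.mem φ → ∃ h : Y ⟶ V, f ≫ h = s ≫ φ) →
    (∀ ⦃V : C⦄ (φ : X ⟶ V), I.mem φ → ∃ (h : Y ⟶ V) (t : W ⟶ V), f ≫ h + s ≫ t = φ) →
    I.ExtendsAlong f

/-- Every object is the source of a monomorphism belonging to the ideal. -/
def HasMonos : Prop :=
  ∀ X : C, ∃ (J : C) (j : X ⟶ J), Mono j ∧ I.mem j

/-- Every object is the target of an epimorphism belonging to the ideal. -/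
def HasEpis : Prop :=
  ∀ X : C, ∃ (P : C) (p : P ⟶ X), Epi p ∧ I.mem p

variable {I}

theorem ExtendsAlong.mono (hI : I.HasMonos) {X Y : C} {f : X ⟶ Y} (hf : I.ExtendsAlong f) :
    Mono f := by
  obtain ⟨J, j, hj, hjI⟩ := hI X
  obtain ⟨h, rfl⟩ := hf j hjI
  exact mono_of_mono f h

theorem hasMonos_op_iff : I.op.HasMonos ↔ I.HasEpis := by
  constructor
  · intro h X
    obtain ⟨J, j, hj, hjI⟩ := h (.op X)
    exact ⟨J.unop, j.unop, inferInstance, hjI⟩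
  · intro h X
    obtain ⟨J, j, hj, hjI⟩ := h X.unop
    exact ⟨.op J, j.op, inferInstance, hjI⟩

theorem extendsAlong_op_iff {X Y : Cᵒᵖ} {f : X ⟶ Y} :
    I.op.ExtendsAlong f ↔ I.LiftsAlong f.unop := by
  constructor
  · intro h U ψ hψ
    obtain ⟨h, hh⟩ := h ψ.op hψ
    exact ⟨h.unop, Quiver.Hom.op_inj hh⟩
  · intro h U ψ hψ
    obtain ⟨h, hh⟩ := h ψ.unop hψ
    exact ⟨h.op, Quiver.Hom.unop_inj hh⟩

end MorphismIdeal

/-! ### Exact structures and saturated ideals in an abelian category. -/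

section Abelian

open scoped ZeroObject

variable {C : Type*} [Category C] [Abelian C]

theorem shortExact_of_isKernelCokernelPair {S : ShortComplex C} (h : IsKernelCokernelPair S) :
    S.ShortExact := by
  obtain ⟨⟨hk⟩, ⟨hc⟩⟩ := h
  exact ShortComplex.ShortExact.mk' (S.exact_of_f_is_kernel hk)
    (Fork.IsLimit.mono hk) (Cofork.IsColimit.epi hc)

theorem isKernelCokernelPair_of_shortExact {S : ShortComplex C} (h : S.ShortExact) :
    IsKernelCokernelPair S :=
  ⟨⟨h.fIsKernel⟩, ⟨h.gIsCokernel⟩⟩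

theorem shortExact_of_isLimit {X Y Z : C} {f : X ⟶ Y} {g : Y ⟶ Z} {w : f ≫ g = 0} [Mono f] [Epi g]
    (h : ∀ ⦃T : C⦄ (t : T ⟶ Y), t ≫ g = 0 → ∃ l : T ⟶ X, l ≫ f = t) :
    (ShortComplex.mk f g w).ShortExact := by
  refine .mk' (ShortComplex.exact_of_f_is_kernel _ ?_) ‹_› ‹_›
  exact KernelFork.IsLimit.ofι' _ _ fun t ht => ⟨(h t ht).choose, (h t ht).choose_spec⟩

theorem shortExact_cokernel {X Y : C} (f : X ⟶ Y) [Mono f] :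
    (ShortComplex.mk f (cokernel.π f) (cokernel.condition f)).ShortExact :=
  .mk' (ShortComplex.exact_cokernel f) ‹_› inferInstance

theorem CategoryTheory.ShortComplex.ShortExact.exists_lift {S : ShortComplex C}
    (hS : S.ShortExact) {T : C} (t : T ⟶ S.X₂) (ht : t ≫ S.g = 0) : ∃ l : T ⟶ S.X₁, l ≫ S.f = t :=
  have := hS.mono_f
  ⟨hS.exact.lift t ht, hS.exact.lift_f t ht⟩

theorem CategoryTheory.ShortComplex.ShortExact.exists_desc {S : ShortComplex C}
    (hS : S.ShortExact) {T : C} (t : S.X₂ ⟶ T) (ht : S.f ≫ t = 0) : ∃ l : S.X₃ ⟶ T, S.g ≫ l = t :=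
  have := hS.epi_g
  ⟨hS.exact.desc t ht, hS.exact.g_desc t ht⟩

namespace ExactStructure

variable (E : ExactStructure C)

variable {E} in
theorem shortExact {S : ShortComplex C} (h : E.exact S) : S.ShortExact :=
  shortExact_of_isKernelCokernelPair (E.isKernelCokernelPair S h)

variable {E} in
theorem isMonoOf_of_exact {S : ShortComplex C} (h : E.exact S) : IsMonoOf E.exact S.f :=
  ⟨_, _, S.zero, h⟩

variable {E} in
theorem isEpiOf_of_exact {S : ShortComplex C} (h : E.exact S) : IsEpiOf E.exact S.g :=
  ⟨_, _, S.zero, h⟩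

theorem mono_of_isMonoOf {X Y : C} {f : X ⟶ Y} (h : IsMonoOf E.exact f) : Mono f := by
  obtain ⟨Z, g, w, h⟩ := h
  exact (shortExact h).mono_f

theorem exact_of_isEpiOf {S : ShortComplex C} (hS : S.ShortExact) (h : IsEpiOf E.exact S.g) :
    E.exact S := by
  obtain ⟨X, f, w, hE⟩ := h
  let e : X ≅ S.X₁ := IsLimit.conePointUniqueUpToIso (shortExact hE).fIsKernel hS.fIsKernel
  have he : e.hom ≫ S.f = f := IsLimit.conePointUniqueUpToIso_hom_comp (shortExact hE).fIsKernel
    hS.fIsKernel WalkingParallelPair.zero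
  exact E.of_iso (S := ShortComplex.mk f S.g w) (ShortComplex.isoMk e (Iso.refl _) (Iso.refl _)
    (by simpa using he) (by simp)) hE

theorem exact_of_isMonoOf {S : ShortComplex C} (hS : S.ShortExact) (h : IsMonoOf E.exact S.f) :
    E.exact S :=
  E.op.exact_of_isEpiOf (S := S.op) hS.op ((isEpiOf_op _).2 h)

/-- An exact structure is closed under pullback of extensions. -/
theorem exact_of_isIso_τ₁ {S T : ShortComplex C} (φ : S ⟶ T) (hS : S.ShortExact)
    (hT : E.exact T) (hφ : IsIso φ.τ₁) : E.exact S := by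
  -- The pulled-back sequence belongs to `E`, and `S` is to be identified with it. The induced map
  -- `m` of kernels is monic and `l ≫ m = φ.τ₁` is invertible, so `m` and `l` are isomorphisms.
  obtain ⟨Y, g, b, hP, X, x, w, hg⟩ := E.epi_pullback T.g φ.τ₃ (isEpiOf_of_exact hT)
  have hTs := shortExact hT
  have hgs := shortExact hg
  have := hTs.mono_f
  have hxm : Mono x := hgs.mono_f
  obtain ⟨t, ht₁, ht₂⟩ : ∃ t : S.X₂ ⟶ Y, t ≫ b = φ.τ₂ ∧ t ≫ g = S.g :=
    ⟨hP.lift φ.τ₂ S.g φ.comm₂₃, hP.lift_fst _ _ _, hP.lift_snd _ _ _⟩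
  obtain ⟨l, hl⟩ := hgs.exists_lift (S.f ≫ t) (by simp [ht₂])
  obtain ⟨m, hm⟩ := hTs.exists_lift (x ≫ b) (by rw [Category.assoc, hP.w, reassoc_of% w, zero_comp])
  dsimp at l hl
  have hlm : l ≫ m = φ.τ₁ := by
    rw [← cancel_mono T.f, Category.assoc, hm, reassoc_of% hl, ht₁, φ.comm₁₂]
  have hmm : Mono m := by
    refine Preadditive.mono_of_cancel_zero _ fun u hu => ?_
    rw [← cancel_mono x, zero_comp]
    refine hP.hom_ext ?_ ?_
    · rw [Category.assoc, ← hm, reassoc_of% hu, zero_comp, zero_comp]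
    · rw [Category.assoc, w, comp_zero, zero_comp]
  have hme : IsSplitEpi m := ⟨⟨⟨inv φ.τ₁ ≫ l, by rw [Category.assoc, hlm]; simp⟩⟩⟩
  have hmi : IsIso m := isIso_of_mono_of_isSplitEpi m
  have hli : IsIso l := by
    have : l = φ.τ₁ ≫ inv m := by rw [← hlm]; simp
    rw [this]; infer_instance
  let ψ : S ⟶ ShortComplex.mk x g w :=
    { τ₁ := l, τ₂ := t, τ₃ := 𝟙 _, comm₁₂ := hl, comm₂₃ := by simpa using ht₂ }
  have h₁ : IsIso ψ.τ₁ := hli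
  have h₃ : IsIso ψ.τ₃ := inferInstanceAs (IsIso (𝟙 _))
  have h₂ : IsIso ψ.τ₂ := ShortComplex.isIso₂_of_shortExact_of_isIso₁₃ ψ hS hgs
  have := ShortComplex.isIso_of_isIso ψ
  exact E.of_iso (asIso ψ).symm hg

/-- The obscure axiom for admissible monomorphisms. -/
theorem isMonoOf_of_comp {X Y Z : C} (f : X ⟶ Y) (j : Y ⟶ Z) (h : IsMonoOf E.exact (f ≫ j)) :
    IsMonoOf E.exact f := by
  have hm := E.mono_of_isMonoOf h
  have : Mono f := mono_of_mono f j
  obtain ⟨W, p, w, hE⟩ := h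
  -- This map is the identity on `X`, so it exhibits the sequence of `f` as a pullback of that of `f
  -- ≫ j`.
  let φ : ShortComplex.mk f (cokernel.π f) (cokernel.condition f) ⟶ ShortComplex.mk (f ≫ j) p w :=
    { τ₁ := 𝟙 _, τ₂ := j, τ₃ := cokernel.desc f (j ≫ p) (by simpa using w) }
  exact isMonoOf_of_exact
    (E.exact_of_isIso_τ₁ φ (shortExact_cokernel f) hE (inferInstanceAs (IsIso (𝟙 _))))

/-- The obscure axiom for admissible epimorphisms. -/
theorem isEpiOf_of_comp {X Y Z : C} (h : X ⟶ Y) (g : Y ⟶ Z) (hg : IsEpiOf E.exact (h ≫ g)) :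
    IsEpiOf E.exact g :=
  (isMonoOf_op g.op).1 (E.op.isMonoOf_of_comp g.op h.op ((isMonoOf_op _).2 hg))

/-- The second condition makes `(f, s)` admissible; its cokernel `Q` is up to sign the pushout of
`f` and `s`. The first makes `W ⟶ Q` admissible, with cokernel `Z`. The composite `Y ⊞ W ⟶ Q ⟶ Z` is
an admissible epimorphism factoring over `Y`, so `Y ⟶ Z` is one by the obscure axiom, and its kernel
is `f`. -/
theorem isSaturated_injectivityIdeal (hE : E.injectivityIdeal.HasMonos)
    (H : ∀ ⦃X Y : C⦄ (f : X ⟶ Y), E.injectivityIdeal.ExtendsAlong f → IsMonoOf E.exact f) :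
    E.injectivityIdeal.IsSaturated := by
  intro X Y W f s h₁ h₂
  have hfs : IsMonoOf E.exact (biprod.lift f s) := H _ fun V φ hφ => by
    obtain ⟨h, t, rfl⟩ := h₂ φ hφ
    exact ⟨biprod.desc h t, by simp⟩
  obtain ⟨Q, π, w, hπ⟩ := hfs
  have hπs := shortExact hπ
  have hπe : Epi π := hπs.epi_g
  have hr : IsMonoOf E.exact (biprod.inr ≫ π) := H _ fun V φ hφ => by
    obtain ⟨h, hh⟩ := h₁ φ hφ
    obtain ⟨k, hk⟩ := hπs.exists_desc (biprod.desc (-h) φ) (by simp [hh])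
    exact ⟨k, by rw [Category.assoc, show π ≫ k = _ from hk]; simp⟩
  have hrm := E.mono_of_isMonoOf hr
  have hw : f ≫ biprod.inl ≫ π = -(s ≫ biprod.inr ≫ π) := by
    rw [eq_neg_iff_add_eq_zero, ← w]
    rw [biprod.lift_eq]
    simp
  have hf : Mono f := by
    obtain ⟨J, j, hj, hjI⟩ := hE X
    obtain ⟨h, t, rfl⟩ := h₂ j hjI
    refine Preadditive.mono_of_cancel_zero _ fun u hu => ?_
    have hus : u ≫ s = 0 := by
      rw [← cancel_mono (biprod.inr ≫ π), zero_comp, Category.assoc, ← neg_eq_zero,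
        ← Preadditive.comp_neg, ← hw, reassoc_of% hu, zero_comp]
    rw [← cancel_mono (f ≫ h + s ≫ t)]
    simp [reassoc_of% hu, reassoc_of% hus]
  obtain ⟨Z, c, wc, hc⟩ := hr
  have hcs := shortExact hc
  have hce : Epi c := hcs.epi_g
  have hg : IsEpiOf E.exact (biprod.inl ≫ π ≫ c) := by
    refine E.isEpiOf_of_comp (biprod.fst : Y ⊞ W ⟶ Y) _ ?_
    have : (biprod.fst : Y ⊞ W ⟶ Y) ≫ biprod.inl ≫ π ≫ c = π ≫ c := by
      ext
      · simp
      · simpa using wc.symm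
    rw [this]
    exact E.epi_comp _ _ (isEpiOf_of_exact hπ) (isEpiOf_of_exact hc)
  have hfg : f ≫ biprod.inl ≫ π ≫ c = 0 := by
    have := congr($hw ≫ c)
    simpa [show biprod.inr ≫ π ≫ c = 0 by simpa using wc] using this
  have hge : Epi (biprod.inl ≫ π ≫ c) := by
    obtain ⟨_, _, _, h⟩ := hg
    exact (shortExact h).epi_g
  have hS : (ShortComplex.mk f _ hfg).ShortExact := shortExact_of_isLimit fun T v hv => by
    obtain ⟨l, hl⟩ := hcs.exists_lift (v ≫ biprod.inl ≫ π) (by simpa using hv)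
    dsimp at l hl
    obtain ⟨x, hx⟩ := hπs.exists_lift (v ≫ biprod.inl - l ≫ biprod.inr)
      (by dsimp; rw [Preadditive.sub_comp, Category.assoc, Category.assoc, hl, sub_self])
    dsimp at x hx
    exact ⟨x, by simpa using congr($hx ≫ biprod.fst)⟩
  have hfE := isMonoOf_of_exact (E.exact_of_isEpiOf hS hg)
  exact fun V φ hφ => hφ _ f hfE

end ExactStructure

namespace MorphismIdeal

variable {I : MorphismIdeal C}

theorem isMonoOf_iff_extendsAlong (hI : I.HasMonos) {X Y : C} (f : X ⟶ Y) :
    IsMonoOf (fun S : ShortComplex C => S.ShortExact ∧ I.ExtendsAlong S.f) f ↔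
      I.ExtendsAlong f := by
  constructor
  · rintro ⟨Z, g, w, h⟩
    exact h.2
  · intro h
    have := h.mono hI
    exact ⟨_, _, _, shortExact_cokernel f, h⟩

theorem ExtendsAlong.comp {X Y Z : C} {f : X ⟶ Y} {g : Y ⟶ Z} (hI : I.IsSaturated)
    (hf : I.ExtendsAlong f) (hg : I.ExtendsAlong g) : I.ExtendsAlong (f ≫ g) := by
  refine hI _ f (fun V φ hφ => ?_) (fun V φ hφ => ?_)
  · obtain ⟨h, rfl⟩ := hg φ hφ
    exact ⟨h, by simp⟩
  · obtain ⟨h, rfl⟩ := hf φ hφ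
    exact ⟨0, h, by simp⟩

/-- The kernel `K` of `p ≫ q` is an extension of `ker q` by `ker p`, and saturation is applied to `K
⟶ X` and `K ⟶ ker q`. A member of `I` on `ker q` extends to `Y`; a member on `K`, after subtracting
an extension to `X` of its restriction to `ker p`, factors through `ker q`. -/
theorem isEpiOf_comp (hI : I.IsSaturated) {X Y Z : C} (p : X ⟶ Y) (q : Y ⟶ Z)
    (hp : IsEpiOf (fun S : ShortComplex C => S.ShortExact ∧ I.ExtendsAlong S.f) p)
    (hq : IsEpiOf (fun S : ShortComplex C => S.ShortExact ∧ I.ExtendsAlong S.f) q) :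
    IsEpiOf (fun S : ShortComplex C => S.ShortExact ∧ I.ExtendsAlong S.f) (p ≫ q) := by
  obtain ⟨A, f₁, w₁, hS₁, hf₁⟩ := hp
  obtain ⟨B, f₂, w₂, hS₂, hf₂⟩ := hq
  have : Epi p := hS₁.epi_g
  have : Epi q := hS₂.epi_g
  have : Mono f₁ := hS₁.mono_f
  have : Mono f₂ := hS₂.mono_f
  dsimp at hf₁ hf₂
  have hK : (ShortComplex.mk (kernel.ι (p ≫ q)) (p ≫ q) (kernel.condition _)).ShortExact :=
    shortExact_of_isLimit fun T t ht => ⟨kernel.lift _ t ht, by simp⟩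
  refine ⟨_, _, _, hK, ?_⟩
  dsimp
  set i := kernel.ι (p ≫ q)
  obtain ⟨a, ha⟩ := hK.exists_lift f₁ (by simp [reassoc_of% w₁])
  obtain ⟨s, hs⟩ := hS₂.exists_lift (i ≫ p) (by simp [i])
  dsimp at a ha s hs
  have has : a ≫ s = 0 := by
    rw [← cancel_mono f₂, Category.assoc, hs, reassoc_of% ha, w₁, zero_comp]
  have hse : Epi s := by
    rw [epi_iff_surjective_up_to_refinements]
    intro T b
    obtain ⟨T', e, he, x, hx⟩ := surjective_up_to_refinements_of_epi p (b ≫ f₂)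
    obtain ⟨k, hk⟩ := hK.exists_lift x (by
      dsimp
      rw [← Category.assoc, ← hx, Category.assoc, Category.assoc, w₂, comp_zero, comp_zero])
    dsimp at k hk
    refine ⟨T', e, he, k, ?_⟩
    rw [← cancel_mono f₂, Category.assoc, Category.assoc, hs, reassoc_of% hk, hx]
  have : Mono (a ≫ i) := by rw [ha]; infer_instance
  have ham : Mono a := mono_of_mono a i
  have hKs : (ShortComplex.mk a s has).ShortExact := shortExact_of_isLimit fun T t ht => by
    obtain ⟨l, hl⟩ := hS₁.exists_lift (t ≫ i) (by
      dsimp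
      rw [Category.assoc, ← hs, reassoc_of% ht, zero_comp])
    dsimp at l hl
    exact ⟨l, by rw [← cancel_mono i, Category.assoc, ha, hl]⟩
  refine hI i s (fun V φ hφ => ?_) (fun V φ hφ => ?_)
  · obtain ⟨h, rfl⟩ := hf₂ φ hφ
    exact ⟨p ≫ h, by rw [← Category.assoc, ← hs, Category.assoc]⟩
  · obtain ⟨h, hh⟩ := hf₁ (a ≫ φ) (I.comp_left_mem a hφ)
    obtain ⟨t, ht⟩ := hKs.exists_desc (φ - i ≫ h)
      (by dsimp; rw [Preadditive.comp_sub, reassoc_of% ha, hh, sub_self])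
    dsimp at t ht
    exact ⟨h, t, by rw [ht]; simp⟩

/-- The exact structure defined by an ideal. -/
def exactStructure (I : MorphismIdeal C) (hI : I.IsSaturated) (hm : I.HasMonos) :
    ExactStructure C where
  exact := fun S => S.ShortExact ∧ I.ExtendsAlong S.f
  isKernelCokernelPair S hS := isKernelCokernelPair_of_shortExact hS.1
  of_iso e hS := ⟨ShortComplex.shortExact_of_iso e hS.1, fun V φ hφ => by
    obtain ⟨h, hh⟩ := hS.2 (e.hom.τ₁ ≫ φ) (I.comp_left_mem _ hφ)
    refine ⟨e.inv.τ₂ ≫ h, ?_⟩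
    rw [← Category.assoc, ← e.inv.comm₁₂, Category.assoc, hh, ← Category.assoc,
      ← ShortComplex.comp_τ₁, e.inv_hom_id]
    simp⟩
  mono_id X := (isMonoOf_iff_extendsAlong hm _).2 fun V φ _ => ⟨φ, by simp⟩
  epi_id X := by
    have : Mono (0 : (0 : C) ⟶ X) := (isZero_zero C).mono _
    refine ⟨0, 0, by simp, shortExact_of_isLimit fun T t ht => ⟨0, ?_⟩,
      fun V φ _ => ⟨0, (isZero_zero C).eq_of_src _ _⟩⟩
    simpa using ht.symm
  mono_comp f g hf hg := (isMonoOf_iff_extendsAlong hm _).2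
    (((isMonoOf_iff_extendsAlong hm _).1 hf).comp hI ((isMonoOf_iff_extendsAlong hm _).1 hg))
  epi_comp f g hf hg := isEpiOf_comp hI f g hf hg
  mono_pushout f a hf := by
    refine ⟨_, _, _, IsPushout.of_hasPushout f a, (isMonoOf_iff_extendsAlong hm _).2 ?_⟩
    intro V φ hφ
    obtain ⟨h, hh⟩ := (isMonoOf_iff_extendsAlong hm _).1 hf (a ≫ φ) (I.comp_left_mem a hφ)
    exact ⟨pushout.desc h φ hh, pushout.inr_desc _ _ _⟩
  epi_pullback g a hg := by
    obtain ⟨X, f, w, hS, hf⟩ := hg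
    have : Epi g := hS.epi_g
    have : Mono f := hS.mono_f
    let f' : X ⟶ pullback g a := pullback.lift f 0 (by simp [w])
    have hf' : f' ≫ pullback.fst g a = f := pullback.lift_fst _ _ _
    have hf'' : f' ≫ pullback.snd g a = 0 := pullback.lift_snd _ _ _
    have : Mono (f' ≫ pullback.fst g a) := by rw [hf']; infer_instance
    have : Mono f' := mono_of_mono f' (pullback.fst g a)
    refine ⟨_, _, _, IsPullback.of_hasPullback g a, X, f', hf'',
      shortExact_of_isLimit fun T t ht => ?_, fun V φ hφ => ?_⟩
    · obtain ⟨l, hl⟩ := hS.exists_lift (t ≫ pullback.fst g a) (by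
        dsimp
        rw [Category.assoc, pullback.condition, reassoc_of% ht, zero_comp])
      dsimp at l hl
      refine ⟨l, pullback.hom_ext ?_ ?_⟩
      · rw [Category.assoc, hf', hl]
      · rw [Category.assoc, hf'', ht, comp_zero]
    · obtain ⟨h, rfl⟩ := hf φ hφ
      exact ⟨pullback.fst g a ≫ h, by dsimp; rw [reassoc_of% hf']⟩

end MorphismIdeal

end Abelian

/-! ### Representable duals of finitely presented functors. -/

section Duality

variable (k E : Type u) [CommRing k] [AddCommGroup E] [Module k E]

/-- `E` is an injective cogenerator for the `k`-modules in the universe `u`. -/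
structure IsInjectiveCogenerator : Prop where
  exists_extension : ∀ {M : Type u} [AddCommGroup M] [Module k M] (N : Submodule k M)
    (l : N →ₗ[k] E), ∃ l' : M →ₗ[k] E, ∀ x : N, l' x = l x
  exists_ne_zero : ∀ {M : Type u} [AddCommGroup M] [Module k M] (N : Submodule k M) {x : M},
    x ∉ N → ∃ l : M →ₗ[k] E, (∀ y ∈ N, l y = 0) ∧ l x ≠ 0

variable {C : Type w} [Category.{u} C] [Preadditive C] [Linear k C]

/-- A functional on `Hom(P, V)` inducing a natural isomorphism between `Hom(-, V)` and the
`E`-dual of `coker Hom(d, -)`. -/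
structure AuslanderPair {P Q : C} (d : P ⟶ Q) (V : C) where
  /-- the functional -/
  θ : (P ⟶ V) →ₗ[k] E
  vanish : ∀ c : Q ⟶ V, θ (d ≫ c) = 0
  exists_target : ∀ (X : C) (l : (P ⟶ X) →ₗ[k] E), (∀ c : Q ⟶ X, l (d ≫ c) = 0) →
    ∃ b : X ⟶ V, ∀ r, l r = θ (r ≫ b)
  target_ext : ∀ (X : C) (b b' : X ⟶ V), (∀ r : P ⟶ X, θ (r ≫ b) = θ (r ≫ b')) → b = b'
  exists_source : ∀ (X : C) (l : (X ⟶ V) →ₗ[k] E), ∃ r : P ⟶ X, ∀ b, l b = θ (r ≫ b)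

variable {k E}

/-- Functionals separate the points of `coker Hom(d, X)`, and each of them comes from some `b : X ⟶
V`. -/
theorem AuslanderPair.exists_fac (hE : IsInjectiveCogenerator k E) {P Q : C} {d : P ⟶ Q} {V : C}
    (A : AuslanderPair k E d V) {X : C} (r : P ⟶ X) (hr : ∀ b : X ⟶ V, A.θ (r ≫ b) = 0) :
    ∃ c : Q ⟶ X, d ≫ c = r := by
  by_contra h
  obtain ⟨l, hl, hlr⟩ := hE.exists_ne_zero (LinearMap.range (Linear.leftComp k X d)) (x := r) h
  obtain ⟨b, hb⟩ := A.exists_target X l fun c => hl _ ⟨c, rfl⟩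
  exact hlr (by rw [hb, hr])

/-- Every representable contravariant functor is the dual of a finitely presented functor. -/
def HasDualPresentations (k E : Type u) [CommRing k] [AddCommGroup E] [Module k E]
    (C : Type w) [Category.{u} C] [Preadditive C] [Linear k C] : Prop :=
  ∀ V : C, ∃ (P Q : C) (d : P ⟶ Q), Nonempty (AuslanderPair k E d V)

namespace MorphismIdeal

variable (I : MorphismIdeal C)

theorem smul_mem {X Y : C} (c : k) {f : X ⟶ Y} (hf : I.mem f) : I.mem (c • f) := by
  have : c • f = (c • 𝟙 X) ≫ f := by simp
  rw [this]
  exact I.comp_left_mem _ hf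

variable (k) in
/-- The morphisms `X ⟶ Y` in an ideal of a `k`-linear category form a `k`-submodule. -/
def homSubmodule (X Y : C) : Submodule k (X ⟶ Y) where
  carrier := {f | I.mem f}
  add_mem' hf hg := I.add_mem _ _ hf hg
  zero_mem' := I.zero_mem X Y
  smul_mem' c _ hf := I.smul_mem c hf

variable {I}

/-- If `Hom(-, V)` is the dual of a finitely presented functor, then a morphism with target `V`
belongs to `I` if it factors through all morphisms along which `I` extends. -/
theorem mem_of_forall_extendsAlong [HasPushouts C] (hE : IsInjectiveCogenerator k E) {P Q : C}
    {d : P ⟶ Q} {V : C} (A : AuslanderPair k E d V) {X : C} (φ : X ⟶ V)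
    (h : ∀ ⦃Y : C⦄ (f : X ⟶ Y), I.ExtendsAlong f → ∃ h : Y ⟶ V, f ≫ h = φ) : I.mem φ := by
  by_contra hφ
  obtain ⟨l, hl, hlφ⟩ := hE.exists_ne_zero (I.homSubmodule k X V) hφ
  obtain ⟨r, hr⟩ := A.exists_source X l
  -- A morphism extends along `pushout.inl r d` if its composite with `r` factors through `d`. This
  -- holds for members of `I` because `l` kills `I`; for `φ` it would force `l φ = 0`.
  obtain ⟨t, ht⟩ := h (pushout.inl r d) fun V' ψ hψ => by
    obtain ⟨c, hc⟩ := A.exists_fac hE (r ≫ ψ) fun b => by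
      rw [Category.assoc, ← hr]
      exact hl _ (I.comp_right_mem b hψ)
    exact ⟨pushout.desc ψ c hc.symm, pushout.inl_desc _ _ _⟩
  apply hlφ
  rw [hr, ← ht, pushout.condition_assoc, A.vanish]

/-- The dual of `coker Hom(-, g)` is `coker Hom(pushout.inl p₀ d, -)`: the latter is the kernel of
the map from `coker Hom(d, -)` to `coker Hom(d', -)` induced by the transpose `t'` of `g`.
Saturation on the opposite side is thus reduced to saturation of `I` at this one morphism. -/
theorem IsSaturated.op [HasPushouts C] (hE : IsInjectiveCogenerator k E)
    (hC : HasDualPresentations k E C) (hI : I.IsSaturated) : I.op.IsSaturated := by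
  intro X' Y' W' f' s' h₁' h₂'
  obtain ⟨Z⟩ := X'
  obtain ⟨Y⟩ := Y'
  obtain ⟨W⟩ := W'
  obtain ⟨g, rfl⟩ : ∃ g : Y ⟶ Z, f' = g.op := ⟨f'.unop, rfl⟩
  obtain ⟨s, rfl⟩ : ∃ s : W ⟶ Z, s' = s.op := ⟨s'.unop, rfl⟩
  rw [extendsAlong_op_iff]
  have h₁ : ∀ ⦃U : C⦄ (ψ : U ⟶ W), I.mem ψ → ∃ h : U ⟶ Y, h ≫ g = ψ ≫ s := fun U ψ hψ => by
    obtain ⟨h, hh⟩ := h₁' ψ.op hψ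
    exact ⟨h.unop, Quiver.Hom.op_inj hh⟩
  have h₂ : ∀ ⦃U : C⦄ (ψ : U ⟶ Z), I.mem ψ →
      ∃ (h : U ⟶ Y) (t : U ⟶ W), h ≫ g + t ≫ s = ψ := fun U ψ hψ => by
    obtain ⟨h, t, hh⟩ := h₂' ψ.op hψ
    exact ⟨h.unop, t.unop, Quiver.Hom.op_inj hh⟩
  clear h₁' h₂'
  obtain ⟨P₀, P₁, d, ⟨A⟩⟩ := hC Z
  obtain ⟨Q₀, Q₁, d', ⟨A'⟩⟩ := hC Y
  obtain ⟨R₀, R₁, d'', ⟨A''⟩⟩ := hC W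
  obtain ⟨t', ht'⟩ := A'.exists_source P₀ (A.θ ∘ₗ Linear.rightComp k P₀ g)
  obtain ⟨t'', ht''⟩ := A''.exists_source P₀ (A.θ ∘ₗ Linear.rightComp k P₀ s)
  simp only [LinearMap.comp_apply, Linear.rightComp_apply] at ht' ht''
  -- A morphism on `P₀` extends along `p₀` exactly when its composite with `t'` factors through
  -- `d'`.
  let p₀ : P₀ ⟶ pushout t' d' := pushout.inl t' d'
  let σ : pushout t' d' ⟶ pushout (t'' ≫ p₀) d'' := pushout.inl _ _
  have hY : ∀ x : pushout t' d' ⟶ Y, A.θ (p₀ ≫ x ≫ g) = 0 := fun x => by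
    rw [← Category.assoc, ht', pushout.condition_assoc, A'.vanish]
  have hW : ∀ x : pushout (t'' ≫ p₀) d'' ⟶ W, A.θ (p₀ ≫ σ ≫ x ≫ s) = 0 := fun x => by
    rw [← Category.assoc, ← Category.assoc, ht'', Category.assoc, ← Category.assoc t'',
      pushout.condition_assoc, A''.vanish]
  have he : I.ExtendsAlong (pushout.inl p₀ d) := by
    -- Duality exchanges subobjects and quotients, so `h₂` yields the first condition and `h₁` the
    -- second.
    refine hI _ σ (fun V φ hφ => ?_) (fun V φ hφ => ?_)
    · obtain ⟨c, hc⟩ := A.exists_fac hE (p₀ ≫ σ ≫ φ) fun b => by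
        obtain ⟨h, t, ht⟩ := h₂ (φ ≫ b) (I.comp_right_mem b hφ)
        rw [Category.assoc, Category.assoc, ← ht, Preadditive.comp_add, Preadditive.comp_add,
          map_add, hW, ← Category.assoc σ, hY, add_zero]
      exact ⟨pushout.desc (σ ≫ φ) c hc.symm, pushout.inl_desc _ _ _⟩
    · obtain ⟨c, hc⟩ := A''.exists_fac hE ((t'' ≫ p₀) ≫ φ) fun b => by
        obtain ⟨h, hh⟩ := h₁ (φ ≫ b) (I.comp_right_mem b hφ)
        have := ht'' (p₀ ≫ φ ≫ b)
        simp only [Category.assoc] at this hh ⊢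
        rw [← this, ← hh, hY]
      exact ⟨0, pushout.desc φ c hc.symm, by rw [comp_zero, zero_add]; exact pushout.inl_desc _ _ _⟩
  intro U ψ hψ
  change ∃ h, h ≫ g = ψ
  by_contra hcon
  obtain ⟨l, hl, hlψ⟩ := hE.exists_ne_zero (LinearMap.range (Linear.rightComp k U g)) hcon
  obtain ⟨r, hr⟩ := A.exists_source U l
  -- Since `l` kills the image of `g`, its representing morphism `r` extends along `p₀`.
  obtain ⟨c, hc⟩ := A'.exists_fac hE (t' ≫ r) fun b => by
    rw [Category.assoc, ← ht', Category.assoc, ← hr]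
    exact hl _ ⟨b, rfl⟩
  obtain ⟨h, hh⟩ := he (pushout.desc r c hc.symm ≫ ψ) (I.comp_left_mem _ hψ)
  have hρ : p₀ ≫ pushout.desc r c hc.symm = r := pushout.inl_desc _ _ _
  apply hlψ
  rw [hr, ← hρ, Category.assoc, ← hh, pushout.condition_assoc, A.vanish]

end MorphismIdeal

end Duality

/-! ### Recovering an exact structure by means of Auslander-Reiten translates. -/

section Abelian

variable {C : Type w} [Category.{u} C] [Abelian C]

/-- `Y` is the quotient of `X ⊞ Q` by the image of `(-ρ, d)`, so the obstruction to extending `m` is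
the class of `ρ ≫ m` in `coker Hom(d, M)`. -/
theorem exists_extension_of_presentation {X Y Z P Q : C} {f : X ⟶ Y} {g : Y ⟶ Z} {w : f ≫ g = 0}
    (hS : (ShortComplex.mk f g w).ShortExact) {d : P ⟶ Q} {π : Q ⟶ Z} {w' : d ≫ π = 0}
    (hd : (ShortComplex.mk d π w').Exact) [Epi π] {q : Q ⟶ Y} (hq : q ≫ g = π) {ρ : P ⟶ X}
    (hρ : ρ ≫ f = d ≫ q) {M : C} (m : X ⟶ M) {c : Q ⟶ M} (hc : d ≫ c = ρ ≫ m) :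
    ∃ h : Y ⟶ M, f ≫ h = m := by
  have : Mono f := hS.mono_f
  have hu : Epi (biprod.desc f q) := by
    rw [epi_iff_surjective_up_to_refinements]
    intro T y
    obtain ⟨T', e, he, p, hp⟩ := surjective_up_to_refinements_of_epi π (y ≫ g)
    obtain ⟨x, hx⟩ := hS.exists_lift (e ≫ y - p ≫ q) (by
      dsimp
      rw [Preadditive.sub_comp, Category.assoc, Category.assoc, hq, hp, sub_self])
    dsimp at x hx
    exact ⟨T', e, he, biprod.lift x p, by simp [hx]⟩
  have hK : (ShortComplex.mk (kernel.ι (biprod.desc f q)) (biprod.desc f q)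
      (kernel.condition _)).ShortExact :=
    shortExact_of_isLimit fun T t ht => ⟨kernel.lift _ t ht, by simp⟩
  have hdesc : ∀ ⦃K : C⦄ (i : K ⟶ X ⊞ Q), i ≫ biprod.desc f q = 0 → i ≫ biprod.desc m c = 0 := by
    intro K i hi
    obtain ⟨x, p, rfl⟩ : ∃ x p, i = biprod.lift x p :=
      ⟨i ≫ biprod.fst, i ≫ biprod.snd, by ext <;> simp⟩
    rw [biprod.lift_desc] at hi ⊢
    have hxp : p ≫ q = -(x ≫ f) := by rw [eq_neg_iff_add_eq_zero, add_comm, hi]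
    have hpπ : p ≫ π = 0 := by
      rw [show p ≫ π = (p ≫ q) ≫ g by rw [Category.assoc, hq], hxp]
      simp [w]
    obtain ⟨T, e, he, y, hy⟩ := hd.exact_up_to_refinements p hpπ
    dsimp at y hy
    have hyx : y ≫ ρ = -(e ≫ x) := by
      rw [← cancel_mono f, Category.assoc, hρ, ← Category.assoc, ← hy, Category.assoc, hxp]
      simp
    rw [← cancel_epi e, comp_zero, Preadditive.comp_add, ← Category.assoc e p, hy, Category.assoc,
      hc, ← Category.assoc y, hyx]
    simp
  obtain ⟨h, hh⟩ := hK.exists_desc (biprod.desc m c) (hdesc _ (kernel.condition _))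
  dsimp at h hh
  exact ⟨h, by rw [← biprod.inl_desc f q, Category.assoc, hh, biprod.inl_desc]⟩

variable {k E : Type u} [CommRing k] [AddCommGroup E] [Module k E] [Linear k C]

/-- Every object `Z` has a projective presentation `P ⟶ Q ⟶ Z ⟶ 0` such that the dual of the
functor `coker (Hom(Q, -) ⟶ Hom(P, -))` is representable, by the Auslander-Reiten translate
of `Z`. -/
def HasTranslates (k E : Type u) [CommRing k] [AddCommGroup E] [Module k E]
    (C : Type w) [Category.{u} C] [Abelian C] [Linear k C] : Prop :=
  ∀ Z : C, ∃ (P Q V : C) (d : P ⟶ Q) (π : Q ⟶ Z) (w : d ≫ π = 0),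
    (ShortComplex.mk d π w).Exact ∧ Epi π ∧ Projective Q ∧ Nonempty (AuslanderPair k E d V)

namespace ExactStructure

variable (𝓔 : ExactStructure C)

/-- The extension given by `f` is encoded by `ρ : P ⟶ X`. If an admissible `m` kills its class, `m`
factors through `f` and the obscure axiom applies. Otherwise a functional detecting `ρ` is a
morphism from `X` to the translate `V` of `coker f`, which lies in the injectivity ideal but cannot
extend along `f`. -/
theorem isMonoOf_of_extendsAlong (hE : IsInjectiveCogenerator k E) (hC : HasTranslates k E C)
    (hnoeth : ∀ X Y : C, IsNoetherian k (X ⟶ Y)) (hm : 𝓔.injectivityIdeal.HasMonos)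
    ⦃X Y : C⦄ (f : X ⟶ Y) (hf : 𝓔.injectivityIdeal.ExtendsAlong f) : IsMonoOf 𝓔.exact f := by
  have := hf.mono hm
  have hS := shortExact_cokernel f
  obtain ⟨P, Q, V, d, π, w, hd, hπ, hQ, ⟨A⟩⟩ := hC (cokernel f)
  obtain ⟨q, hq⟩ : ∃ q : Q ⟶ Y, q ≫ cokernel.π f = π :=
    ⟨Projective.factorThru π (cokernel.π f), by simp⟩
  obtain ⟨ρ, hρ⟩ := hS.exists_lift (d ≫ q) (by dsimp; rw [Category.assoc, hq, w])
  dsimp at ρ hρ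
  -- `K m` consists of the `r` whose class dies in `coker Hom(d, M)` under `m`.
  let K : ∀ ⦃M : C⦄ (m : X ⟶ M), Submodule k (P ⟶ X) := fun M m =>
    (LinearMap.range (Linear.leftComp k M d)).comap (Linear.rightComp k P m)
  have hKm : ∀ ⦃M : C⦄ (m : X ⟶ M) (r : P ⟶ X), r ∈ K m ↔ ∃ c : Q ⟶ M, d ≫ c = r ≫ m :=
    fun M m r => Iff.rfl
  have hKcomp : ∀ ⦃M N : C⦄ (m : X ⟶ M) (n : M ⟶ N), K m ≤ K (m ≫ n) := fun M N m n r hr => by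
    obtain ⟨c, hc⟩ := (hKm _ _).1 hr
    exact (hKm _ _).2 ⟨c ≫ n, by rw [← Category.assoc, hc, Category.assoc]⟩
  obtain ⟨_, ⟨M, m, hmE, rfl⟩, hmax⟩ := set_has_maximal_iff_noetherian.2 (hnoeth P X)
    {N | ∃ (M : C) (m : X ⟶ M), IsMonoOf 𝓔.exact m ∧ N = K m} ⟨_, X, 𝟙 X, 𝓔.mono_id X, rfl⟩
  -- Admissible monomorphisms out of `X` are directed by pushout, so a maximal `K m` is the greatest
  -- one.
  have hKle : ∀ ⦃M' : C⦄ (m' : X ⟶ M'), IsMonoOf 𝓔.exact m' → K m' ≤ K m := by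
    intro M' m' hm'
    obtain ⟨N, b, a, hP, ha⟩ := 𝓔.mono_pushout m m' hmE
    have hle : K m ≤ K (m' ≫ a) := by rw [← hP.w]; exact hKcomp m b
    have heq : K m = K (m' ≫ a) := by
      by_contra hne
      exact hmax _ ⟨_, _, 𝓔.mono_comp _ _ hm' ha, rfl⟩ (lt_of_le_of_ne hle hne)
    rw [heq]
    exact hKcomp m' a
  by_cases hρm : ρ ∈ K m
  · obtain ⟨c, hc⟩ := (hKm _ _).1 hρm
    obtain ⟨h, rfl⟩ := exists_extension_of_presentation hS hd hq hρ m hc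
    exact 𝓔.isMonoOf_of_comp f h hmE
  · exfalso
    obtain ⟨l, hl, hlρ⟩ := hE.exists_ne_zero (K m) hρm
    obtain ⟨φ, hφ⟩ := A.exists_target X l fun c => hl _ ((hKm _ _).2 ⟨c ≫ m, by simp⟩)
    have hφI : 𝓔.injectivityIdeal.mem φ := by
      intro M' m' hm'
      -- As `l` kills `K m'`, it descends to `Hom(P, X) / K m'`, which embeds in `coker Hom(d, M')`;
      -- injectivity of `E` extends it there.
      obtain ⟨l', hl'⟩ : ∃ l' : (P ⟶ M') →ₗ[k] E, (∀ c : Q ⟶ M', l' (d ≫ c) = 0) ∧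
          ∀ r, l' (r ≫ m') = l r := by
        let T := (P ⟶ M') ⧸ LinearMap.range (Linear.leftComp k M' d)
        let j : ((P ⟶ X) ⧸ K m') →ₗ[k] T :=
          (K m').mapQ _ (Linear.rightComp k P m') le_rfl
        have hj : Function.Injective j := by
          rw [← LinearMap.ker_eq_bot, Submodule.ker_mapQ]
          exact (Submodule.eq_bot_iff _).2 (by
            rintro _ ⟨x, hx, rfl⟩
            exact (Submodule.Quotient.mk_eq_zero _).2 hx)
        let l₀ : ((P ⟶ X) ⧸ K m') →ₗ[k] E :=
          (K m').liftQ l fun r hr => hl r (hKle m' hm' hr)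
        obtain ⟨l₁, hl₁⟩ := hE.exists_extension (LinearMap.range j)
          (l₀ ∘ₗ (LinearEquiv.ofInjective j hj).symm.toLinearMap)
        refine ⟨l₁ ∘ₗ Submodule.mkQ _, fun c => ?_, fun r => ?_⟩
        · have : (LinearMap.range (Linear.leftComp k M' d)).mkQ (d ≫ c) = 0 :=
            (Submodule.Quotient.mk_eq_zero _).2 ⟨c, rfl⟩
          rw [LinearMap.comp_apply, this, map_zero]
        · have := hl₁ (LinearEquiv.ofInjective j hj (Submodule.Quotient.mk r))
          rw [LinearMap.comp_apply, LinearEquiv.coe_coe, LinearEquiv.symm_apply_apply] at this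
          exact this
      obtain ⟨b, hb⟩ := A.exists_target M' l' hl'.1
      refine ⟨b, A.target_ext _ _ _ fun r => ?_⟩
      rw [← hφ, ← hl'.2, hb, Category.assoc]
    obtain ⟨h, hh⟩ := hf φ hφI
    apply hlρ
    rw [hφ, ← hh, ← Category.assoc, hρ, Category.assoc, A.vanish]

end ExactStructure

variable (C) in
/-- The exact structures correspond to the saturated ideals with enough monomorphisms. -/
noncomputable def exactStructureEquiv (hE : IsInjectiveCogenerator k E)
    (hC : HasTranslates k E C) (hC' : HasDualPresentations k E C)
    (hnoeth : ∀ X Y : C, IsNoetherian k (X ⟶ Y)) [EnoughInjectives C] :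
    ExactStructure C ≃ {I : MorphismIdeal C // I.IsSaturated ∧ I.HasMonos} :=
  have hm : ∀ 𝓔 : ExactStructure C, 𝓔.injectivityIdeal.HasMonos := fun 𝓔 X =>
    ⟨Injective.under X, Injective.ι X, inferInstance, fun M m hm => by
      have := 𝓔.mono_of_isMonoOf hm
      exact ⟨Injective.factorThru (Injective.ι X) m, by simp⟩⟩
  have hmono : ∀ 𝓔 : ExactStructure C, ∀ ⦃X Y : C⦄ (f : X ⟶ Y),
      𝓔.injectivityIdeal.ExtendsAlong f → IsMonoOf 𝓔.exact f := fun 𝓔 =>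
    𝓔.isMonoOf_of_extendsAlong hE hC hnoeth (hm 𝓔)
  { toFun := fun 𝓔 => ⟨𝓔.injectivityIdeal, 𝓔.isSaturated_injectivityIdeal (hm 𝓔) (hmono 𝓔), hm 𝓔⟩
    invFun := fun I => I.1.exactStructure I.2.1 I.2.2
    left_inv := fun 𝓔 => by
      ext S
      exact ⟨fun h => 𝓔.exact_of_isMonoOf h.1 (hmono 𝓔 _ h.2),
        fun h => ⟨ExactStructure.shortExact h, fun V φ hφ =>
          hφ _ _ (ExactStructure.isMonoOf_of_exact h)⟩⟩
    right_inv := fun I => by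
      ext X V φ
      obtain ⟨P, Q, d, ⟨A⟩⟩ := hC' V
      refine ⟨fun h => ?_, fun h M m hm => ?_⟩
      · exact MorphismIdeal.mem_of_forall_extendsAlong hE A φ fun Y f hf =>
          h Y f ((MorphismIdeal.isMonoOf_iff_extendsAlong I.2.2 f).2 hf)
      · exact (MorphismIdeal.isMonoOf_iff_extendsAlong I.2.2 m).1 hm φ h }

end Abelian

/-! ### Fp-idempotent ideals and saturated ideals. -/

section Functors

open Opposite

theorem shortComplex_exact_of_evaluation {C : Type w} [Category.{u} C]
    (T : ShortComplex (C ⥤ AddCommGrpCat.{u}))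
    (h : ∀ V : C, (T.map ((evaluation C AddCommGrpCat.{u}).obj V)).Exact) : T.Exact := by
  rw [ShortComplex.exact_iff_isZero_homology, Functor.isZero_iff]
  intro V
  have := h V
  rw [ShortComplex.exact_iff_isZero_homology] at this
  exact this.of_iso (T.mapHomologyIso ((evaluation C AddCommGrpCat.{u}).obj V)).symm

variable {C : Type w} [Category.{u} C] [Preadditive C]

/-- The components of a natural transformation `Hom(X, -) ⟶ F`. -/
def coyonedaEval {X : C} {F : C ⥤ AddCommGrpCat.{u}} (σ : preadditiveCoyoneda.obj (op X) ⟶ F)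
    (V : C) : (X ⟶ V) →+ F.obj V :=
  (σ.app V).hom

/-- The projection from `Hom(X, -)` to `coker Hom(f, -)`. -/
noncomputable def cokerHomπ {X Y : C} (f : X ⟶ Y) :
    preadditiveCoyoneda.obj (op X) ⟶ cokerHom f :=
  cokernel.π (preadditiveCoyoneda.map f.op)

/-- The natural transformation `Hom(X, -) ⟶ F` with components `σ` is surjective with kernel
the image of `Hom(f, -)`. -/
structure IsPresentation {X Y : C} (f : X ⟶ Y) (F : C ⥤ AddCommGrpCat.{u})
    (σ : preadditiveCoyoneda.obj (op X) ⟶ F) : Prop where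
  surjective : ∀ (V : C) (x : F.obj V), ∃ a : X ⟶ V, coyonedaEval σ V a = x
  eq_zero_iff : ∀ (V : C) (a : X ⟶ V), coyonedaEval σ V a = 0 ↔ ∃ h : Y ⟶ V, f ≫ h = a

theorem coyoneda_naturality {X U V : C} {F : C ⥤ AddCommGrpCat.{u}}
    (σ : preadditiveCoyoneda.obj (op X) ⟶ F) (a : X ⟶ U) (φ : U ⟶ V) :
    (F.map φ).hom (coyonedaEval σ U a) = coyonedaEval σ V (a ≫ φ) :=
  (congr($(σ.naturality φ) a)).symm

theorem isPresentation_cokerHom {X Y : C} (f : X ⟶ Y) :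
    IsPresentation f (cokerHom f) (cokerHomπ f) := by
  let S : ShortComplex (C ⥤ AddCommGrpCat.{u}) := .mk (preadditiveCoyoneda.map f.op)
    (cokernel.π (preadditiveCoyoneda.map f.op)) (cokernel.condition _)
  have hS : S.Exact := ShortComplex.exact_cokernel _
  refine ⟨fun V => ?_, fun V a => ?_⟩
  · exact (AddCommGrpCat.epi_iff_surjective
      ((cokernel.π (preadditiveCoyoneda.map f.op)).app V)).1 inferInstance
  · have := hS.map ((evaluation C AddCommGrpCat.{u}).obj V)
    rw [ShortComplex.ab_exact_iff] at this
    refine ⟨this a, ?_⟩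
    rintro ⟨h, rfl⟩
    exact ConcreteCategory.congr_hom
      (congr_app (cokernel.condition (preadditiveCoyoneda.map f.op)) V) h

theorem exists_desc_cokerHom {X Y : C} {f : X ⟶ Y} {G : C ⥤ AddCommGrpCat.{u}}
    (τ : preadditiveCoyoneda.obj (op X) ⟶ G)
    (hτ : coyonedaEval τ Y f = 0) : ∃ δ : cokerHom f ⟶ G,
      ∀ (V : C) (a : X ⟶ V), (δ.app V).hom
        (coyonedaEval (cokerHomπ f) V a) = coyonedaEval τ V a := by
  have h : preadditiveCoyoneda.map f.op ≫ τ = 0 := by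
    ext V h
    change Y ⟶ V at h
    exact (coyoneda_naturality τ f h).symm.trans (by rw [hτ, map_zero]; rfl)
  refine ⟨cokernel.desc _ τ h, fun V a => ?_⟩
  exact ConcreteCategory.congr_hom
    (congr_app (cokernel.π_desc (preadditiveCoyoneda.map f.op) τ h) V) a

namespace IsPresentation

variable {X Y : C} {f : X ⟶ Y} {F : C ⥤ AddCommGrpCat.{u}}
  {σ : preadditiveCoyoneda.obj (op X) ⟶ F}

theorem of_iso {G : C ⥤ AddCommGrpCat.{u}} (hσ : IsPresentation f F σ) (e : F ≅ G) :
    IsPresentation f G (σ ≫ e.hom) where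
  surjective V x := by
    obtain ⟨a, ha⟩ := hσ.surjective V ((e.inv.app V).hom x)
    refine ⟨a, ?_⟩
    change (e.hom.app V).hom (coyonedaEval σ V a) = x
    rw [ha]
    exact ConcreteCategory.congr_hom (e.inv_hom_id_app V) x
  eq_zero_iff V a := by
    rw [← hσ.eq_zero_iff]
    change (e.hom.app V).hom (coyonedaEval σ V a) = 0 ↔ _
    refine ⟨fun h => ?_, fun h => by rw [h, map_zero]⟩
    have := ConcreteCategory.congr_hom (e.hom_inv_id_app V) (coyonedaEval σ V a)
    change (e.inv.app V).hom ((e.hom.app V).hom (coyonedaEval σ V a)) = coyonedaEval σ V a at this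
    rw [← this, h, map_zero]

theorem map_eq_zero_iff (hσ : IsPresentation f F σ) {U V : C} (φ : U ⟶ V) :
    F.map φ = 0 ↔ ∀ a : X ⟶ U, ∃ h : Y ⟶ V, f ≫ h = a ≫ φ := by
  constructor
  · intro h a
    rw [← hσ.eq_zero_iff, ← coyoneda_naturality, h]
    rfl
  · intro h
    ext x
    obtain ⟨a, rfl⟩ := hσ.surjective U x
    rw [coyoneda_naturality, (hσ.eq_zero_iff _ _).2 (h a)]
    rfl

/-- `F` is generated by the image of `𝟙 X`, and `I` is closed under precomposition, so vanishing
need only be tested on that generator. -/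
theorem vanishes_iff (hσ : IsPresentation f F σ) (I : MorphismIdeal C) :
    (∀ ⦃U V : C⦄ (φ : U ⟶ V), I.mem φ → F.map φ = 0) ↔ I.ExtendsAlong f := by
  constructor
  · intro h V φ hφ
    obtain ⟨t, ht⟩ := (hσ.map_eq_zero_iff φ).1 (h φ hφ) (𝟙 X)
    exact ⟨t, by simpa using ht⟩
  · intro h U V φ hφ
    exact (hσ.map_eq_zero_iff φ).2 fun a => h _ (I.comp_left_mem a hφ)

end IsPresentation

theorem IsFpFunctor.exists_isPresentation {F : C ⥤ AddCommGrpCat.{u}} (hF : IsFpFunctor F) :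
    ∃ (X Y : C) (f : X ⟶ Y) (σ : preadditiveCoyoneda.obj (op X) ⟶ F), IsPresentation f F σ := by
  obtain ⟨X, Y, f, ⟨e⟩⟩ := hF
  exact ⟨X, Y, f, _, (isPresentation_cokerHom f).of_iso e.symm⟩

theorem isFpFunctor_cokerHom {X Y : C} (f : X ⟶ Y) : IsFpFunctor (cokerHom f) :=
  ⟨X, Y, f, ⟨Iso.refl _⟩⟩

theorem isFpFunctor_of_isZero (X : C) {F : C ⥤ AddCommGrpCat.{u}} (hF : IsZero F) :
    IsFpFunctor F := by
  have : IsIso (preadditiveCoyoneda.map (𝟙 X).op) := inferInstance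
  exact ⟨X, X, 𝟙 X, ⟨hF.iso (isZero_cokernel_of_epi _)⟩⟩

namespace MorphismIdeal

variable {I : MorphismIdeal C}

theorem annihilator_cokerHom_iff {X Y : C} (f : X ⟶ Y) :
    I.annihilator (cokerHom f) ↔ I.ExtendsAlong f :=
  ⟨fun h => ((isPresentation_cokerHom f).vanishes_iff I).1 h.2,
    fun h => ⟨isFpFunctor_cokerHom f, ((isPresentation_cokerHom f).vanishes_iff I).2 h⟩⟩

/-- There is a short exact sequence from `coker Hom(pushout.inr f s, -)` over `coker Hom(f, -)` to
`coker Hom((f, s), -)`; the two conditions say that its outer terms vanish on `I`. -/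
theorem IsFpIdempotent.isSaturated [HasPushouts C] [HasBinaryBiproducts C]
    (hI : I.IsFpIdempotent) : I.IsSaturated := by
  intro X Y W f s h₁ h₂
  have P := isPresentation_cokerHom f
  have P₁ := isPresentation_cokerHom (pushout.inr f s)
  have P₂ := isPresentation_cokerHom (biprod.lift f s)
  obtain ⟨α, hα⟩ := exists_desc_cokerHom (f := pushout.inr f s)
    (preadditiveCoyoneda.map s.op ≫ cokerHomπ f)
    ((P.eq_zero_iff _ (s ≫ pushout.inr f s)).2 ⟨_, pushout.condition⟩)
  obtain ⟨β, hβ⟩ := exists_desc_cokerHom (f := f)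
    (cokerHomπ (biprod.lift f s))
    ((P₂.eq_zero_iff _ f).2 ⟨biprod.fst, by simp⟩)
  replace hα : ∀ (V : C) (b : W ⟶ V), (α.app V).hom
      (coyonedaEval (cokerHomπ (pushout.inr f s)) V b) = coyonedaEval (cokerHomπ f) V (s ≫ b) := hα
  have w : α ≫ β = 0 := by
    ext V x
    obtain ⟨b, rfl⟩ := P₁.surjective V x
    change (β.app V).hom ((α.app V).hom _) = 0
    rw [hα, hβ, P₂.eq_zero_iff]
    exact ⟨biprod.snd ≫ b, by simp⟩
  have hT : (ShortComplex.mk α β w).ShortExact := by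
    refine .mk' (shortComplex_exact_of_evaluation _ fun V => ?_) ?_ ?_
    · rw [ShortComplex.ab_exact_iff]
      intro x hx
      obtain ⟨a, rfl⟩ := P.surjective V x
      change (β.app V).hom _ = 0 at hx
      rw [hβ, P₂.eq_zero_iff] at hx
      obtain ⟨h, rfl⟩ := hx
      refine ⟨coyonedaEval (cokerHomπ (pushout.inr f s)) V
        (biprod.inr ≫ h), ?_⟩
      refine (hα _ _).trans ?_
      rw [← sub_eq_zero, ← map_sub, P.eq_zero_iff]
      refine ⟨-(biprod.inl ≫ h), ?_⟩
      rw [biprod.lift_eq]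
      simp
    · rw [NatTrans.mono_iff_mono_app]
      intro V
      rw [AddCommGrpCat.mono_iff_injective, injective_iff_map_eq_zero]
      intro x hx
      obtain ⟨b, rfl⟩ := P₁.surjective V x
      obtain ⟨h, hh⟩ := (P.eq_zero_iff _ _).1 ((hα _ _).symm.trans hx)
      exact (P₁.eq_zero_iff _ _).2 ⟨pushout.desc h b hh, pushout.inr_desc _ _ _⟩
    · rw [NatTrans.epi_iff_epi_app]
      intro V
      rw [AddCommGrpCat.epi_iff_surjective]
      intro x
      obtain ⟨b, rfl⟩ := P₂.surjective V x
      exact ⟨_, hβ _ _⟩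
  refine (annihilator_cokerHom_iff f).1 ((hI.iff_of_shortExact _ hT (isFpFunctor_cokerHom _)
    (isFpFunctor_cokerHom _) (isFpFunctor_cokerHom _)).2 ⟨?_, ?_⟩)
  · refine (annihilator_cokerHom_iff _).2 fun V φ hφ => ?_
    obtain ⟨h, hh⟩ := h₁ φ hφ
    exact ⟨pushout.desc h φ hh, pushout.inr_desc _ _ _⟩
  · refine (annihilator_cokerHom_iff _).2 fun V φ hφ => ?_
    obtain ⟨h, t, rfl⟩ := h₂ φ hφ
    exact ⟨biprod.desc h t, by simp⟩

/-- Passing to subobjects and quotients is formal. For extensions, the generator of the left term is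
represented in the middle term by a morphism `s`, and saturation is applied to `s` and a
presentation `f` of the middle term. -/
theorem IsSaturated.isFpIdempotent [Nonempty C] (hI : I.IsSaturated) : I.IsFpIdempotent where
  le_fp F hF := hF.1
  zero F hF := ⟨isFpFunctor_of_isZero (Classical.arbitrary C) hF, fun X Y φ _ =>
    (Functor.isZero_iff _).1 hF Y |>.eq_of_tgt _ _⟩
  iff_of_shortExact T hT h₁ h₂ h₃ := by
    have hm := hT.mono_f
    have he := hT.epi_g
    rw [NatTrans.mono_iff_mono_app] at hm
    rw [NatTrans.epi_iff_epi_app] at he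
    refine ⟨fun h => ⟨⟨h₁, fun X Y φ hφ => ?_⟩, ⟨h₃, fun X Y φ hφ => ?_⟩⟩, fun h => ⟨h₂, ?_⟩⟩
    · rw [← cancel_mono (T.f.app Y), T.f.naturality, h.2 φ hφ, zero_comp, comp_zero]
    · rw [← cancel_epi (T.g.app X), ← T.g.naturality, h.2 φ hφ, zero_comp, comp_zero]
    · obtain ⟨X, Y, f, σ, hσ⟩ := h₂.exists_isPresentation
      obtain ⟨W, W', f', σ', hσ'⟩ := h₁.exists_isPresentation
      rw [hσ.vanishes_iff]
      obtain ⟨s, hs⟩ := hσ.surjective W ((T.f.app W).hom (coyonedaEval σ' W (𝟙 W)))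
      have hs' : ∀ (V : C) (b : W ⟶ V),
          (T.f.app V).hom (coyonedaEval σ' V b) = coyonedaEval σ V (s ≫ b) := fun V b => by
        have h := coyoneda_naturality σ' (𝟙 W) b
        rw [Category.id_comp] at h
        rw [← coyoneda_naturality, hs, ← h]
        exact ConcreteCategory.congr_hom (T.f.naturality b) (coyonedaEval σ' W (𝟙 W))
      refine hI f s (fun V φ hφ => ?_) (fun V φ hφ => ?_)
      · have h0 : coyonedaEval σ' V φ = 0 := by
          have := coyoneda_naturality σ' (𝟙 W) φ
          rw [Category.id_comp] at this
          rw [← this, h.1.2 φ hφ]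
          rfl
        rw [← hσ.eq_zero_iff, ← hs', h0, map_zero]
      · have h0 : (T.g.app V).hom (coyonedaEval σ V φ) = 0 := by
          have := coyoneda_naturality (σ ≫ T.g) (𝟙 X) φ
          rw [Category.id_comp, h.2.2 φ hφ] at this
          exact this.symm
        have hex := hT.exact.map ((evaluation C AddCommGrpCat.{u}).obj V)
        rw [ShortComplex.ab_exact_iff] at hex
        obtain ⟨y, hy⟩ := hex _ h0
        change T.X₁.obj V at y
        change (T.f.app V).hom y = _ at hy
        obtain ⟨b, rfl⟩ := hσ'.surjective V y
        rw [hs', ← sub_eq_zero, ← map_sub, hσ.eq_zero_iff] at hy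
        obtain ⟨h, hh⟩ := hy
        exact ⟨-h, b, by rw [Preadditive.comp_neg, hh]; simp⟩

end MorphismIdeal

end Functors

/-! ### Contravariant functors, and the sequences attached to an ideal. -/

section Functors

open Opposite

variable {C : Type w} [Category.{u} C] [Preadditive C]

theorem cokerHomOp_map_eq_zero_iff {Y Z : C} (g : Y ⟶ Z) {U V : C} (ψ : U ⟶ V) :
    (cokerHomOp g).map ψ.op = 0 ↔ ∀ a : V ⟶ Z, ∃ h : U ⟶ Y, h ≫ g = ψ ≫ a := by
  let S : ShortComplex (Cᵒᵖ ⥤ AddCommGrpCat.{u}) := .mk (preadditiveYoneda.map g)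
    (cokernel.π (preadditiveYoneda.map g)) (cokernel.condition _)
  have hS : S.Exact := ShortComplex.exact_cokernel _
  let ev : ∀ T : C, (T ⟶ Z) →+ (cokerHomOp g).obj (op T) := fun T =>
    ((cokernel.π (preadditiveYoneda.map g)).app (op T)).hom
  have hev : ∀ T : C, Function.Surjective (ev T) := fun T =>
    (AddCommGrpCat.epi_iff_surjective
      ((cokernel.π (preadditiveYoneda.map g)).app (op T))).1 inferInstance
  have hz : ∀ (T : C) (a : T ⟶ Z), ev T a = 0 ↔ ∃ h : T ⟶ Y, h ≫ g = a := fun T a => by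
    have := hS.map ((evaluation Cᵒᵖ AddCommGrpCat.{u}).obj (op T))
    rw [ShortComplex.ab_exact_iff] at this
    refine ⟨this a, ?_⟩
    rintro ⟨h, rfl⟩
    exact ConcreteCategory.congr_hom
      (congr_app (cokernel.condition (preadditiveYoneda.map g)) (op T)) h
  have hn : ∀ a : V ⟶ Z, ((cokerHomOp g).map ψ.op).hom (ev V a) = ev U (ψ ≫ a) := fun a =>
    (ConcreteCategory.congr_hom
      ((cokernel.π (preadditiveYoneda.map g)).naturality ψ.op) a).symm
  constructor
  · intro h a
    rw [← hz, ← hn, h]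
    rfl
  · intro h
    ext x
    obtain ⟨a, rfl⟩ := hev V x
    rw [hn, (hz _ _).2 (h a)]
    rfl

namespace MorphismIdeal

variable {I : MorphismIdeal C}

theorem leftExact_iff (S : ShortComplex C) : I.leftExact S ↔
    Nonempty (IsColimit (CokernelCofork.ofπ S.g S.zero)) ∧ I.ExtendsAlong S.f :=
  and_congr_right fun _ => (isPresentation_cokerHom S.f).vanishes_iff I

theorem rightExact_iff (S : ShortComplex C) : I.rightExact S ↔
    Nonempty (IsLimit (KernelFork.ofι S.f S.zero)) ∧ I.LiftsAlong S.g := by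
  refine and_congr_right fun _ => ⟨fun h U ψ hψ => ?_, fun h U V ψ hψ => ?_⟩
  · obtain ⟨t, ht⟩ := (cokerHomOp_map_eq_zero_iff S.g ψ).1 (h ψ hψ) (𝟙 _)
    exact ⟨t, by simpa using ht⟩
  · exact (cokerHomOp_map_eq_zero_iff S.g ψ).2 fun a => h _ (I.comp_right_mem a hψ)

end MorphismIdeal

end Functors

section Abelian

variable {C : Type w} [Category.{u} C] [Abelian C] {I : MorphismIdeal C}

namespace MorphismIdeal

theorem isFpIdempotent_iff_isSaturated : I.IsFpIdempotent ↔ I.IsSaturated :=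
  have : Nonempty C := ⟨(HasZeroObject.zero' C).zero⟩
  ⟨IsFpIdempotent.isSaturated, IsSaturated.isFpIdempotent⟩

/-- Only a cokernel is required on the left; exactness at the first term is automatic, as
`ExtendsAlong` forces a monomorphism. -/
theorem leftExact_iff_shortExact (hI : I.HasMonos) (S : ShortComplex C) :
    I.leftExact S ↔ S.ShortExact ∧ I.ExtendsAlong S.f := by
  rw [leftExact_iff]
  refine and_congr_left fun h => ⟨fun ⟨hc⟩ => ?_, fun hS => ⟨hS.gIsCokernel⟩⟩
  exact .mk' (S.exact_of_g_is_cokernel hc) (h.mono hI) (Cofork.IsColimit.epi hc)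

theorem leftExact_op_iff (S : ShortComplex C) : I.op.leftExact S.op ↔ I.rightExact S := by
  rw [leftExact_iff, rightExact_iff]
  refine and_congr ⟨fun h => ?_, fun h => ?_⟩ extendsAlong_op_iff
  · exact h.map (CokernelCofork.IsColimit.ofπUnop _ _)
  · exact h.map (KernelFork.IsLimit.ofιOp _ _)

end MorphismIdeal

end Abelian

/-! ### Nakayama pairs. -/

section Opposites

open Opposite

variable {k E : Type u} [CommRing k] [AddCommGroup E] [Module k E]
variable {C : Type w} [Category.{u} C] [Preadditive C] [Linear k C]

instance linearOpposite : Linear k Cᵒᵖ where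
  homModule X Y :=
    { smul := fun c f => (c • f.unop).op
      one_smul := fun f => Quiver.Hom.unop_inj (one_smul k f.unop)
      mul_smul := fun a b f => Quiver.Hom.unop_inj (mul_smul a b f.unop)
      smul_zero := fun a => Quiver.Hom.unop_inj (smul_zero (A := Y.unop ⟶ X.unop) a)
      smul_add := fun a f g => Quiver.Hom.unop_inj (smul_add a f.unop g.unop)
      add_smul := fun a b f => Quiver.Hom.unop_inj (add_smul a b f.unop)
      zero_smul := fun f => Quiver.Hom.unop_inj (zero_smul k f.unop) }
  smul_comp _ _ _ r f g := Quiver.Hom.unop_inj (Linear.comp_smul _ _ _ g.unop r f.unop)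
  comp_smul _ _ _ f r g := Quiver.Hom.unop_inj (Linear.smul_comp _ _ _ r g.unop f.unop)

variable (k) in
/-- Morphisms in the opposite category, linearly. -/
def unopLinearEquiv (X Y : Cᵒᵖ) : (X ⟶ Y) ≃ₗ[k] (Y.unop ⟶ X.unop) where
  toFun f := f.unop
  invFun f := f.op
  map_add' _ _ := rfl
  map_smul' _ _ := rfl

variable (k E) in
/-- A functional on `Hom(P, J)` inducing natural isomorphisms between `Hom(-, J)` and the `E`-dual
of `Hom(P, -)`, and between `Hom(P, -)` and the `E`-dual of `Hom(-, J)`. -/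
structure NakayamaPair (P J : C) where
  /-- the functional -/
  θ : (P ⟶ J) →ₗ[k] E
  exists_target : ∀ (X : C) (l : (P ⟶ X) →ₗ[k] E), ∃ b : X ⟶ J, ∀ r, l r = θ (r ≫ b)
  target_ext : ∀ (X : C) (b b' : X ⟶ J), (∀ r : P ⟶ X, θ (r ≫ b) = θ (r ≫ b')) → b = b'
  exists_source : ∀ (X : C) (l : (X ⟶ J) →ₗ[k] E), ∃ r : P ⟶ X, ∀ b, l b = θ (r ≫ b)
  source_ext : ∀ (X : C) (r r' : P ⟶ X), (∀ b : X ⟶ J, θ (r ≫ b) = θ (r' ≫ b)) → r = r'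

/-- The opposite of a Nakayama pair. -/
def NakayamaPair.op {P J : C} (N : NakayamaPair k E P J) :
    NakayamaPair k E (Opposite.op J) (Opposite.op P) where
  θ := N.θ ∘ₗ (unopLinearEquiv k _ _).toLinearMap
  exists_target X l := by
    obtain ⟨r, hr⟩ := N.exists_source X.unop (l ∘ₗ (unopLinearEquiv k _ _).symm.toLinearMap)
    exact ⟨r.op, fun b => hr b.unop⟩
  target_ext X b b' h :=
    Quiver.Hom.unop_inj (N.source_ext X.unop b.unop b'.unop fun r => h r.op)
  exists_source X l := by
    obtain ⟨r, hr⟩ := N.exists_target X.unop (l ∘ₗ (unopLinearEquiv k _ _).symm.toLinearMap)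
    exact ⟨r.op, fun b => hr b.unop⟩
  source_ext X b b' h :=
    Quiver.Hom.unop_inj (N.target_ext X.unop b.unop b'.unop fun r => h r.op)

/-- A functional `θ` with values in an injective cogenerator inducing a bijection between
`Hom(X, J)` and the dual of `Hom(P, X)` yields a Nakayama pair if the modules `Hom(P, X)` are
reflexive. -/
theorem NakayamaPair.exists_of_reflexive (hE : IsInjectiveCogenerator k E) {P J : C}
    (θ : (P ⟶ J) →ₗ[k] E)
    (h₁ : ∀ (X : C) (l : (P ⟶ X) →ₗ[k] E), ∃ b : X ⟶ J, ∀ r, l r = θ (r ≫ b))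
    (h₂ : ∀ (X : C) (b b' : X ⟶ J), (∀ r : P ⟶ X, θ (r ≫ b) = θ (r ≫ b')) → b = b')
    (hP : ∀ (X : C) (l : ((P ⟶ X) →ₗ[k] E) →ₗ[k] E), ∃ r, ∀ b, l b = b r) :
    Nonempty (NakayamaPair k E P J) := by
  let D : ∀ X : C, (X ⟶ J) →ₗ[k] ((P ⟶ X) →ₗ[k] E) := fun X =>
    LinearMap.mk₂ k (fun b r => θ (r ≫ b)) (by simp) (by simp) (by simp) (by simp)
  have hD : ∀ X, Function.Bijective (D X) := fun X => by
    refine ⟨fun b b' h => h₂ X b b' fun r => congr($h r), fun l => ?_⟩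
    obtain ⟨b, hb⟩ := h₁ X l
    exact ⟨b, LinearMap.ext fun r => (hb r).symm⟩
  refine ⟨⟨θ, h₁, h₂, fun X l => ?_, fun X r r' h => ?_⟩⟩
  · let e := LinearEquiv.ofBijective (D X) (hD X)
    obtain ⟨r, hr⟩ := hP X (l ∘ₗ e.symm.toLinearMap)
    refine ⟨r, fun b => ?_⟩
    have := hr (e b)
    rwa [LinearMap.comp_apply, LinearEquiv.coe_coe, LinearEquiv.symm_apply_apply] at this
  · by_contra hne
    obtain ⟨l, -, hl⟩ := hE.exists_ne_zero (⊥ : Submodule k (P ⟶ X)) (x := r - r')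
      (by simpa [sub_eq_zero] using hne)
    obtain ⟨b, hb⟩ := h₁ X l
    exact hl (by rw [map_sub, hb, hb, h, sub_self])

/-- A functional killing all morphisms from `P` that lift along the epimorphism `p` is given by some
`b` with `p ≫ b = 0`, so it is zero. -/
theorem NakayamaPair.projective (hE : IsInjectiveCogenerator k E) {P J : C}
    (N : NakayamaPair k E P J) : Projective P where
  factors {Z M} f p hp := by
    by_contra h
    obtain ⟨l, hl, hlf⟩ := hE.exists_ne_zero (LinearMap.range (Linear.rightComp k P p)) (x := f) h
    obtain ⟨b, hb⟩ := N.exists_target _ l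
    have : p ≫ b = 0 := N.target_ext _ _ _ fun r => by
      rw [← Category.assoc, ← hb, comp_zero, map_zero]
      exact hl _ ⟨r, rfl⟩
    apply hlf
    rw [hb, (cancel_epi p).1 (this.trans comp_zero.symm), comp_zero, map_zero]

theorem NakayamaPair.injective (hE : IsInjectiveCogenerator k E) {P J : C}
    (N : NakayamaPair k E P J) : Injective J :=
  Injective.injective_iff_projective_op.2 (N.op.projective hE)

/-- The kernel of the morphism corresponding to `δ` under Nakayama pairs represents the dual of
`coker Hom(δ, -)`. -/
theorem NakayamaPair.exists_auslanderPair (hE : IsInjectiveCogenerator k E) {P J P' J' V : C}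
    (N : NakayamaPair k E P J) (N' : NakayamaPair k E P' J') {δ : P ⟶ P'} {γ : J ⟶ J'}
    (h : ∀ r : P' ⟶ J, N'.θ (r ≫ γ) = N.θ (δ ≫ r)) (i : V ⟶ J) [Mono i] (hi : i ≫ γ = 0)
    (hV : ∀ ⦃X : C⦄ (b : X ⟶ J), b ≫ γ = 0 → ∃ b' : X ⟶ V, b' ≫ i = b) :
    Nonempty (AuslanderPair k E δ V) := by
  refine ⟨⟨N.θ ∘ₗ Linear.rightComp k P i, fun c => ?_, fun X l hl => ?_, fun X b b' hb => ?_,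
    fun X l => ?_⟩⟩
  · simp [← h, hi]
  · obtain ⟨b, hb⟩ := N.exists_target X l
    obtain ⟨b', rfl⟩ := hV b (N'.target_ext _ _ _ fun r => by
      rw [← Category.assoc, h, ← Category.assoc, ← hb, hl, comp_zero, map_zero])
    exact ⟨b', fun r => by simpa using hb r⟩
  · rw [← cancel_mono i]
    exact N.target_ext _ _ _ fun r => by simpa using hb r
  -- `Hom(X, V)` embeds in `Hom(X, J)`; the functional is extended there before being represented.
  · have hinj : Function.Injective (Linear.rightComp k X i) := fun b b' hb =>
      (cancel_mono i).1 hb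
    obtain ⟨l', hl'⟩ := hE.exists_extension (LinearMap.range (Linear.rightComp k X i))
      (l ∘ₗ (LinearEquiv.ofInjective _ hinj).symm.toLinearMap)
    obtain ⟨r, hr⟩ := N.exists_source X l'
    refine ⟨r, fun b => ?_⟩
    have := hl' (LinearEquiv.ofInjective _ hinj b)
    rw [LinearMap.comp_apply, LinearEquiv.coe_coe, LinearEquiv.symm_apply_apply] at this
    rw [← this, LinearEquiv.ofInjective_apply, hr]
    simp

end Opposites

/-! ### Dualizing categories and the two bijections. -/

section Abelian

variable {k E : Type u} [CommRing k] [AddCommGroup E] [Module k E]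
variable {C : Type w} [Category.{u} C] [Abelian C] [Linear k C]

/-- A `k`-linear abelian category with noetherian morphism modules and with enough Nakayama pairs,
as for instance the category of finitely generated modules over an Artin algebra. -/
structure IsDualizing (k E : Type u) [CommRing k] [AddCommGroup E] [Module k E]
    (C : Type w) [Category.{u} C] [Abelian C] [Linear k C] : Prop where
  cogenerator : IsInjectiveCogenerator k E
  noetherian : ∀ X Y : C, IsNoetherian k (X ⟶ Y)
  exists_epi : ∀ X : C, ∃ (P J : C) (p : P ⟶ X), Epi p ∧ Nonempty (NakayamaPair k E P J)
  exists_mono : ∀ X : C, ∃ (P J : C) (i : X ⟶ J), Mono i ∧ Nonempty (NakayamaPair k E P J)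

namespace IsDualizing

theorem op (hC : IsDualizing k E C) : IsDualizing k E Cᵒᵖ where
  cogenerator := hC.cogenerator
  noetherian X Y :=
    have := hC.noetherian Y.unop X.unop
    isNoetherian_of_linearEquiv (unopLinearEquiv k X Y).symm
  exists_epi X := by
    obtain ⟨P, J, i, hi, ⟨N⟩⟩ := hC.exists_mono X.unop
    exact ⟨.op J, .op P, i.op, inferInstance, ⟨N.op⟩⟩
  exists_mono X := by
    obtain ⟨P, J, i, hi, ⟨N⟩⟩ := hC.exists_epi X.unop
    exact ⟨.op J, .op P, i.op, inferInstance, ⟨N.op⟩⟩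

/-- An injective copresentation `V ⟶ J ⟶ J'` is transposed to a morphism `P ⟶ P'` between the
Nakayama partners. -/
theorem hasDualPresentations (hC : IsDualizing k E C) : HasDualPresentations k E C := by
  intro V
  obtain ⟨P, J, i, hi, ⟨N⟩⟩ := hC.exists_mono V
  obtain ⟨P', J', j, hj, ⟨N'⟩⟩ := hC.exists_mono (cokernel i)
  obtain ⟨δ, hδ⟩ := N.exists_source P' (N'.θ ∘ₗ Linear.rightComp k P' (cokernel.π i ≫ j))
  refine ⟨P, P', δ, N.exists_auslanderPair hC.cogenerator N' hδ i (by simp) fun X b hb => ?_⟩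
  exact (shortExact_cokernel i).exists_lift b (by
    rwa [← cancel_mono j, Category.assoc, zero_comp])

/-- The translate is the kernel of the Nakayama functor applied to a projective presentation `P ⟶ Q`
of `Z`. -/
theorem hasTranslates (hC : IsDualizing k E C) : HasTranslates k E C := by
  intro Z
  obtain ⟨Q, J, π, hπ, ⟨N⟩⟩ := hC.exists_epi Z
  obtain ⟨P, J', p, hp, ⟨N'⟩⟩ := hC.exists_epi (kernel π)
  obtain ⟨γ, hγ⟩ := N.exists_target J' (N'.θ ∘ₗ Linear.leftComp k J' (p ≫ kernel.ι π))
  refine ⟨P, Q, kernel γ, p ≫ kernel.ι π, π, by simp, ?_, hπ, N.projective hC.cogenerator,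
    N'.exists_auslanderPair hC.cogenerator N (fun r => (hγ r).symm) (kernel.ι γ) (by simp)
      fun X b hb => ⟨kernel.lift γ b hb, by simp⟩⟩
  rw [ShortComplex.exact_iff_exact_up_to_refinements]
  intro T x hx
  obtain ⟨T', e, he, y, hy⟩ := surjective_up_to_refinements_of_epi p (kernel.lift π x hx)
  exact ⟨T', e, he, y, by simpa using congr($hy ≫ kernel.ι π)⟩

theorem enoughInjectives (hC : IsDualizing k E C) : EnoughInjectives C := by
  refine ⟨fun X => ?_⟩
  obtain ⟨P, J, i, hi, ⟨N⟩⟩ := hC.exists_mono X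
  exact ⟨⟨J, N.injective hC.cogenerator, i, hi⟩⟩

/-- Exact structures on a dualizing category correspond to saturated ideals with enough
monomorphisms, by taking injectivity ideals. -/
noncomputable def injectivityEquiv (hC : IsDualizing k E C) :
    ExactStructure C ≃ {I : MorphismIdeal C // I.IsSaturated ∧ I.HasMonos} :=
  have := hC.enoughInjectives
  exactStructureEquiv C hC.cogenerator hC.hasTranslates hC.hasDualPresentations hC.noetherian

theorem isSaturated_op_iff (hC : IsDualizing k E C) {I : MorphismIdeal C} :
    I.op.IsSaturated ↔ I.IsSaturated := by
  refine ⟨fun h => ?_, fun h => h.op hC.cogenerator hC.hasDualPresentations⟩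
  -- Duality for `Cᵒᵖ` gives saturation in the double opposite, which is then unwrapped.
  have h' := h.op hC.op.cogenerator hC.op.hasDualPresentations
  intro X Y W f s h₁ h₂ V φ hφ
  obtain ⟨t, ht⟩ := h' f.op.op s.op.op (fun V φ hφ => by
      obtain ⟨t, ht⟩ := h₁ φ.unop.unop hφ
      exact ⟨t.op.op, Quiver.Hom.unop_inj (Quiver.Hom.unop_inj ht)⟩) (fun V φ hφ => by
      obtain ⟨t, t', ht⟩ := h₂ φ.unop.unop hφ
      exact ⟨t.op.op, t'.op.op, Quiver.Hom.unop_inj (Quiver.Hom.unop_inj ht)⟩) φ.op.op hφ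
  exact ⟨t.unop.unop, Quiver.Hom.op_inj (Quiver.Hom.op_inj ht)⟩

/-- Exact structures on a dualizing category correspond to saturated ideals with enough
epimorphisms, by taking projectivity ideals. -/
noncomputable def projectivityEquiv (hC : IsDualizing k E C) :
    ExactStructure C ≃ {I : MorphismIdeal C // I.IsSaturated ∧ I.HasEpis} :=
  (ExactStructure.opEquiv C).trans (hC.op.injectivityEquiv.trans
    ((MorphismIdeal.opEquiv C).subtypeEquiv fun _ =>
      and_congr hC.isSaturated_op_iff.symm MorphismIdeal.hasMonos_op_iff.symm).symm)

theorem injectivityEquiv_apply (hC : IsDualizing k E C) (𝓔 : ExactStructure C) :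
    (hC.injectivityEquiv 𝓔).1 = 𝓔.injectivityIdeal := rfl

theorem projectivityEquiv_apply (hC : IsDualizing k E C) (𝓔 : ExactStructure C) :
    (hC.projectivityEquiv 𝓔).1 = 𝓔.projectivityIdeal :=
  congr_arg MorphismIdeal.unop 𝓔.injectivityIdeal_op

theorem injectivityEquiv_symm_exact (hC : IsDualizing k E C)
    (I : {I : MorphismIdeal C // I.IsSaturated ∧ I.HasMonos}) :
    (hC.injectivityEquiv.symm I).exact = I.1.leftExact := by
  ext S
  exact (MorphismIdeal.leftExact_iff_shortExact I.2.2 S).symm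

theorem projectivityEquiv_symm_exact (hC : IsDualizing k E C)
    (I : {I : MorphismIdeal C // I.IsSaturated ∧ I.HasEpis}) :
    (hC.projectivityEquiv.symm I).exact = I.1.rightExact := by
  ext S
  rw [← MorphismIdeal.leftExact_op_iff,
    ← hC.op.injectivityEquiv_symm_exact ⟨I.1.op, hC.isSaturated_op_iff.2 I.2.1,
      MorphismIdeal.hasMonos_op_iff.2 I.2.2⟩]
  rfl

end IsDualizing

end Abelian

/-! ### Essential hulls inside injective modules. -/

section EssentialExtensions

variable {R : Type u} [CommRing R] {I : Type u} [AddCommGroup I] [Module R I]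

/-- Every submodule `S` of an injective module is contained in a direct summand in which it is
essential. -/
theorem exists_essential_retract [Module.Injective R I] (S : Submodule R I) :
    ∃ (E : Submodule R I) (π : I →ₗ[R] E), S ≤ E ∧ (∀ x : E, π x = x) ∧
      ∀ x ∈ E, x ≠ 0 → ∃ a : R, a • x ≠ 0 ∧ a • x ∈ S := by
  obtain ⟨E, hSE, hE⟩ := zorn_le_nonempty₀
    {E : Submodule R I | S ≤ E ∧ ∀ x ∈ E, x ≠ 0 → ∃ a : R, a • x ≠ 0 ∧ a • x ∈ S}
    (fun c hc hchain y hy => by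
      refine ⟨sSup c, ⟨(hc hy).1.trans (le_sSup hy), fun x hx => ?_⟩, fun z hz => le_sSup hz⟩
      obtain ⟨N, hN, hxN⟩ := (Submodule.mem_sSup_of_directed ⟨y, hy⟩ hchain.directedOn).1 hx
      exact (hc hN).2 x hxN)
    S ⟨le_rfl, fun x hx hx0 => ⟨1, by simpa using hx0, by simpa using hx⟩⟩
  -- `E` is a maximal essential extension of `S` in `I`, and `C` is maximal with `C ∩ E = 0`. As `E`
  -- embeds in `I / C`, its inclusion extends to a map `π` killing `C`.
  obtain ⟨C, -, hC⟩ := zorn_le_nonempty₀ {C : Submodule R I | ∀ x ∈ C, x ∈ E → x = 0}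
    (fun c hc hchain y hy => by
      refine ⟨sSup c, fun x hx => ?_, fun z hz => le_sSup hz⟩
      obtain ⟨N, hN, hxN⟩ := (Submodule.mem_sSup_of_directed ⟨y, hy⟩ hchain.directedOn).1 hx
      exact hc hN x hxN)
    ⊥ (fun x hx _ => by simpa using hx)
  have hinj : Function.Injective (C.mkQ ∘ₗ E.subtype) := by
    rw [injective_iff_map_eq_zero]
    intro x hx
    exact Subtype.ext (hC.prop x ((Submodule.Quotient.mk_eq_zero C).1 hx) x.2)
  obtain ⟨h, hh⟩ := Module.Injective.out (Q := I) _ hinj E.subtype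
  let π := h ∘ₗ C.mkQ
  have hπE : ∀ x ∈ E, π x = x := fun x hx => hh ⟨x, hx⟩
  have hπC : ∀ x ∈ C, π x = 0 := fun x hx => by
    change h (Submodule.Quotient.mk x) = 0
    rw [(Submodule.Quotient.mk_eq_zero C).2 hx, map_zero]
  have hle : E ≤ LinearMap.range π := fun x hx => ⟨x, hπE x hx⟩
  -- The range is again essential over `S`, so equals `E` by maximality: if `π x ≠ 0`, then `x ∉ C`,
  -- so `C + Rx` meets `E`, and `π` shows the common element to be a multiple of `π x`.
  have hmem : LinearMap.range π ≤ E := by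
    refine hE.le_of_ge ⟨hSE.trans hle, ?_⟩ hle
    rintro _ ⟨x, rfl⟩ hx
    obtain ⟨e, he, heE, he0⟩ : ∃ e ∈ C ⊔ Submodule.span R {x}, e ∈ E ∧ e ≠ 0 := by
      by_contra! hcon
      refine hx (hπC x (hC.le_of_ge (y := C ⊔ Submodule.span R {x}) ?_ le_sup_left
        (Submodule.mem_sup_right (Submodule.mem_span_singleton_self x))))
      exact hcon
    obtain ⟨y, hy, z, hz, rfl⟩ := Submodule.mem_sup.1 he
    obtain ⟨a, rfl⟩ := Submodule.mem_span_singleton.1 hz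
    have hπe : y + a • x = a • π x := by
      rw [← hπE _ heE, map_add, hπC y hy, zero_add, map_smul]
    obtain ⟨b, hb, hbS⟩ := hE.prop.2 _ heE he0
    rw [hπe, ← mul_smul] at hb hbS
    exact ⟨b * a, hb, hbS⟩
  exact ⟨E, π.codRestrict E fun x => hmem ⟨x, rfl⟩, hSE, fun x => Subtype.ext (hπE x x.2),
    hE.prop.2⟩

end EssentialExtensions

/-! ### Matlis duality for modules of finite length. -/

section Matlis

variable (R : Type u) [CommRing R]

/-- There is an injective cogenerator whose socle contains each simple module with multiplicity
one. -/
theorem exists_injectiveCogenerator : ∃ (E : Type u) (_ : AddCommGroup E) (_ : Module R E),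
    IsInjectiveCogenerator R E ∧
      ∀ (T : Type u) [AddCommGroup T] [Module R T] [IsSimpleModule R T],
        Module.length R (T →ₗ[R] E) ≤ 1 := by
  classical
  -- Each simple module occurs once; essentiality over the product keeps further simple submodules
  -- out of `E`.
  let S := ∀ m : MaximalSpectrum R, R ⧸ m.asIdeal
  let I : ModuleCat.{u} R := Injective.under (ModuleCat.of R S)
  let ι : S →ₗ[R] I := (Injective.ι (ModuleCat.of R S)).hom
  have hι : Function.Injective ι :=
    (ModuleCat.mono_iff_injective (Injective.ι (ModuleCat.of R S))).1 inferInstance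
  have hI : Injective (ModuleCat.of R I) := inferInstanceAs (Injective I)
  have : Module.Injective R I := Module.injective_module_of_injective_object R I
  obtain ⟨E, π, hSE, hπ, hess⟩ := exists_essential_retract (LinearMap.range ι)
  have hext : ∀ {M : Type u} [AddCommGroup M] [Module R M] (N : Submodule R M)
      (l : N →ₗ[R] E), ∃ l' : M →ₗ[R] E, ∀ x : N, l' x = l x := fun N l => by
    obtain ⟨l', hl'⟩ := Module.Injective.out (Q := I) N.subtype N.injective_subtype
      (E.subtype ∘ₗ l)
    refine ⟨π ∘ₗ l', fun x => ?_⟩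
    have := hl' x
    rw [LinearMap.comp_apply, show l' x = _ from this]
    exact hπ _
  refine ⟨E, inferInstance, inferInstance, ⟨hext, fun {M} _ _ N x hx => ?_⟩, ?_⟩
  · have hx' : N.mkQ x ≠ 0 := fun h => hx ((Submodule.Quotient.mk_eq_zero N).1 h)
    -- The cyclic module generated by the class of `x` has a simple quotient, which embeds in `E`.
    let s : R →ₗ[R] M ⧸ N := LinearMap.toSpanSingleton R _ (N.mkQ x)
    have hs : LinearMap.ker s ≠ (⊤ : Ideal R) := by
      rw [Ideal.ne_top_iff_one]
      intro h
      exact hx' (by simpa [s] using h)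
    obtain ⟨m, hm, hsm⟩ := Ideal.exists_le_maximal _ hs
    obtain ⟨p, rfl⟩ : ∃ p : MaximalSpectrum R, p.asIdeal = m := ⟨⟨m, hm⟩, rfl⟩
    let j : (R ⧸ p.asIdeal) →ₗ[R] E :=
      (ι ∘ₗ LinearMap.single R (fun m : MaximalSpectrum R => R ⧸ m.asIdeal) p).codRestrict E
        fun y => hSE ⟨_, rfl⟩
    have hj : Function.Injective j := by
      rw [LinearMap.injective_codRestrict_iff]
      exact hι.comp (Pi.single_injective (M := fun m : MaximalSpectrum R => R ⧸ m.asIdeal) p)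
    obtain ⟨l, hl⟩ := hext (LinearMap.range s)
      (j ∘ₗ (LinearMap.ker s).mapQ p.asIdeal LinearMap.id hsm ∘ₗ
      s.quotKerEquivRange.symm.toLinearMap)
    refine ⟨l ∘ₗ N.mkQ, fun y hy => ?_, fun h0 => ?_⟩
    · rw [LinearMap.comp_apply, show N.mkQ y = 0 from (Submodule.Quotient.mk_eq_zero N).2 hy,
        map_zero]
    · have h1 := hl (s.quotKerEquivRange (Submodule.Quotient.mk 1))
      have h2 : ((s.quotKerEquivRange (Submodule.Quotient.mk 1) : LinearMap.range s) : M ⧸ N) =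
        N.mkQ x := by
        rw [s.quotKerEquivRange_apply_mk]
        exact one_smul R _
      rw [h2, show l (N.mkQ x) = 0 from h0, LinearMap.comp_apply, LinearMap.comp_apply,
        LinearEquiv.coe_coe, LinearEquiv.symm_apply_apply, eq_comm, ← map_zero j] at h1
      have h3 : (Submodule.Quotient.mk 1 : R ⧸ p.asIdeal) = 0 := hj h1
      exact hm.ne_top ((Ideal.eq_top_iff_one _).2 ((Submodule.Quotient.mk_eq_zero p.asIdeal).1 h3))
  · intro T _ _ hT
    obtain ⟨m, hm, ⟨e⟩⟩ := isSimpleModule_iff_quot_maximal.1 hT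
    obtain ⟨p, rfl⟩ : ∃ p : MaximalSpectrum R, p.asIdeal = m := ⟨⟨m, hm⟩, rfl⟩
    let j : (R ⧸ p.asIdeal) →ₗ[R] I :=
      ι ∘ₗ LinearMap.single R (fun m : MaximalSpectrum R => R ⧸ m.asIdeal) p
    -- Evaluation at a generator embeds the dual of `T` into the elements of `E` killed by `p`;
    -- these are shown to lie in the factor `R ⧸ p`.
    let ev : (T →ₗ[R] E) →ₗ[R] I := E.subtype ∘ₗ LinearMap.applyₗ (e.symm (Submodule.Quotient.mk 1))
    have hone : ∀ (f : T →ₗ[R] E) (a : R), a ∈ p.asIdeal →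
        a • f (e.symm (Submodule.Quotient.mk 1)) = 0 := by
      intro f a ha
      rw [← map_smul, ← map_smul, ← Submodule.Quotient.mk_smul, smul_eq_mul, mul_one,
        (Submodule.Quotient.mk_eq_zero p.asIdeal).2 ha, map_zero, map_zero]
    have hev : Function.Injective ev := by
      rw [injective_iff_map_eq_zero]
      intro f hf
      have hf1 : f (e.symm (Submodule.Quotient.mk 1)) = 0 := Subtype.ext hf
      ext t
      obtain ⟨a, ha⟩ := Submodule.Quotient.mk_surjective p.asIdeal (e t)
      have : t = a • e.symm (Submodule.Quotient.mk 1) := by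
        rw [← map_smul, ← Submodule.Quotient.mk_smul, smul_eq_mul, mul_one, ha, e.symm_apply_apply]
      rw [this, map_smul, hf1, smul_zero, LinearMap.zero_apply]
    have hrange : LinearMap.range ev ≤ LinearMap.range j := by
      rintro _ ⟨f, rfl⟩
      by_cases h0 : ev f = 0
      · rw [h0]; exact zero_mem _
      obtain ⟨a, ha0, ⟨s, hs⟩⟩ := hess (ev f) (f _).2 h0
      have hann : ∀ b ∈ p.asIdeal, b • ev f = 0 := fun b hb => congr_arg Subtype.val (hone f b hb)
      have ham : a ∉ p.asIdeal := fun h => ha0 (hann a h)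
      -- `a` is invertible modulo `p`, which kills `ev f`; so `ev f` itself, not only a multiple,
      -- lies in the product.
      obtain ⟨b, hb⟩ := hm.exists_inv ham
      obtain ⟨c, hc, hbc⟩ := hb
      have hbs : ι (b • s) = ev f := by
        rw [map_smul, hs, smul_smul, ← add_zero ((b * a) • ev f), ← hann c hc, ← add_smul, hbc,
          one_smul]
      refine ⟨(b • s) p, ?_⟩
      rw [← hbs]
      refine congr_arg ι ?_
      ext m'
      by_cases hmm : m' = p
      · subst hmm
        exact Pi.single_eq_same (M := fun m : MaximalSpectrum R => R ⧸ m.asIdeal) m' _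
      · rw [LinearMap.coe_single, Pi.single_eq_of_ne hmm]
        obtain ⟨a', ha', ham'⟩ : ∃ a' ∈ p.asIdeal, a' ∉ m'.asIdeal := by
          by_contra! hcon
          exact hmm (MaximalSpectrum.ext (hm.eq_of_le m'.isMaximal.ne_top hcon).symm)
        have h0 : a' • (b • s) = 0 := hι (by rw [map_smul, hbs, hann a' ha', map_zero])
        have h0' := congr_fun h0 m'
        obtain ⟨y, hy⟩ := Submodule.Quotient.mk_surjective m'.asIdeal ((b • s) m')
        rw [Pi.smul_apply, ← hy, ← Submodule.Quotient.mk_smul, Pi.zero_apply,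
          Submodule.Quotient.mk_eq_zero] at h0'
        rw [← hy, eq_comm, Submodule.Quotient.mk_eq_zero]
        exact (m'.isMaximal.isPrime.mem_or_mem h0').resolve_left ham'
    have hsimple : IsSimpleModule R (R ⧸ p.asIdeal) :=
      isSimpleModule_iff_quot_maximal.2 ⟨_, hm, ⟨.refl _ _⟩⟩
    calc Module.length R (T →ₗ[R] E)
        = Module.length R (LinearMap.range ev) := (LinearEquiv.ofInjective ev hev).length_eq
      _ ≤ Module.length R (LinearMap.range j) :=
        Module.length_le_of_injective (Submodule.inclusion hrange)
          (Submodule.inclusion_injective hrange)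
      _ ≤ Module.length R (R ⧸ p.asIdeal) :=
        Module.length_le_of_surjective j.rangeRestrict j.surjective_rangeRestrict
      _ = 1 := Module.length_eq_one R _

variable {R} {E : Type u} [AddCommGroup E] [Module R E]

/-- Induction along a composition series: the kernel of restriction to `N` is contained in the image
of the dual of the simple module `M ⧸ N`. -/
theorem length_dual_le
    (hE : ∀ (T : Type u) [AddCommGroup T] [Module R T] [IsSimpleModule R T],
      Module.length R (T →ₗ[R] E) ≤ 1)
    {M : Type u} [AddCommGroup M] [Module R M] (hM : IsFiniteLength R M) :
    Module.length R (M →ₗ[R] E) ≤ Module.length R M := by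
  induction hM with
  | of_subsingleton => simp [Module.length_eq_zero]
  | @of_simple_quotient M _ _ N _ hN ih =>
    let r : (M →ₗ[R] E) →ₗ[R] (N →ₗ[R] E) := LinearMap.lcomp R E N.subtype
    let q : ((M ⧸ N) →ₗ[R] E) →ₗ[R] (M →ₗ[R] E) := LinearMap.lcomp R E N.mkQ
    have hq : LinearMap.ker r ≤ LinearMap.range q := fun f hf => by
      have hf' : N ≤ LinearMap.ker f := fun x hx => LinearMap.congr_fun hf (⟨x, hx⟩ : N)
      exact ⟨N.liftQ f hf', N.liftQ_mkQ f hf'⟩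
    have h₁ : Module.length R (LinearMap.ker r) ≤ 1 :=
      (Module.length_le_of_injective (Submodule.inclusion hq)
        (Submodule.inclusion_injective hq)).trans
        ((Module.length_le_of_surjective q.rangeRestrict q.surjective_rangeRestrict).trans (hE _))
    have h₂ : Module.length R (LinearMap.range r) ≤ Module.length R N :=
      (Module.length_le_of_injective (LinearMap.range r).subtype
        (Submodule.injective_subtype _)).trans ih
    rw [Module.length_eq_add_of_exact (LinearMap.ker r).subtype r.rangeRestrict
      (Submodule.injective_subtype _) r.surjective_rangeRestrict
      (by rw [LinearMap.exact_iff, LinearMap.ker_rangeRestrict, Submodule.range_subtype]),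
      Module.length_eq_add_of_exact N.subtype N.mkQ N.injective_subtype N.mkQ_surjective
      (LinearMap.exact_subtype_mkQ N), Module.length_eq_one R (M ⧸ N), add_comm]
    exact add_le_add h₂ h₁

/-- Modules of finite length are reflexive. -/
theorem exists_eq_eval (hE : IsInjectiveCogenerator R E)
    (hE' : ∀ (T : Type u) [AddCommGroup T] [Module R T] [IsSimpleModule R T],
      Module.length R (T →ₗ[R] E) ≤ 1)
    {M : Type u} [AddCommGroup M] [Module R M] (hM : IsFiniteLength R M)
    (l : (M →ₗ[R] E) →ₗ[R] E) : ∃ x : M, ∀ f : M →ₗ[R] E, l f = f x := by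
  have hM' := Module.length_ne_top_iff.2 hM
  have hD : Module.length R (M →ₗ[R] E) ≠ ⊤ := ne_top_of_le_ne_top hM' (length_dual_le hE' hM)
  have hDD := length_dual_le hE' (Module.length_ne_top_iff.1 hD)
  have hDD' := ne_top_of_le_ne_top hD hDD
  let ev : M →ₗ[R] ((M →ₗ[R] E) →ₗ[R] E) := LinearMap.applyₗ
  have hev : Function.Injective ev := by
    rw [injective_iff_map_eq_zero]
    intro x hx
    by_contra hne
    obtain ⟨f, -, hf⟩ := hE.exists_ne_zero (⊥ : Submodule R M) (x := x) hne
    exact hf congr($hx f)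
  obtain ⟨_, _⟩ := isFiniteLength_iff_isNoetherian_isArtinian.1 (Module.length_ne_top_iff.1 hDD')
  -- The length bound applied twice leaves no room for a proper image of the injective map `ev`.
  have htop : LinearMap.range ev = ⊤ := by
    by_contra hne
    have := Submodule.length_lt hne
    rw [← (LinearEquiv.ofInjective ev hev).length_eq] at this
    exact absurd (this.trans_le (hDD.trans (length_dual_le hE' hM))) (lt_irrefl _)
  obtain ⟨x, rfl⟩ := LinearMap.range_eq_top.1 htop l
  exact ⟨x, fun f => rfl⟩

end Matlis

/-! ### The modules `D(Aⁿ)`. -/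

section DualModule

variable (K A E : Type u) [CommRing K] [Ring A] [Algebra K A] [AddCommGroup E] [Module K E] (n : ℕ)

/-- The `E`-dual of the right `A`-module `Aⁿ`. -/
def DualModule : Type u := (Fin n → A) →ₗ[K] E

namespace DualModule

variable {K A E n}

instance : AddCommGroup (DualModule K A E n) := inferInstanceAs (AddCommGroup (_ →ₗ[K] E))

/-- The functional underlying an element of the dual module. -/
def eval (f : DualModule K A E n) : (Fin n → A) →ₗ[K] E := f

theorem eval_ext {f g : DualModule K A E n}
    (h : ∀ (i : Fin n) (a : A), f.eval (Pi.single i a) = g.eval (Pi.single i a)) : f = g :=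
  LinearMap.pi_ext h

instance : SMul A (DualModule K A E n) where
  smul a f := f.eval ∘ₗ (LinearMap.mulRight K a).compLeft (Fin n)

theorem smul_eval (a : A) (f : DualModule K A E n) (y : Fin n → A) :
    (a • f).eval y = f.eval fun i => y i * a := rfl

@[simp]
theorem add_eval (f g : DualModule K A E n) (y : Fin n → A) :
    (f + g).eval y = f.eval y + g.eval y := rfl

@[simp]
theorem zero_eval (y : Fin n → A) : (0 : DualModule K A E n).eval y = 0 := rfl

instance : Module A (DualModule K A E n) where
  one_smul f := LinearMap.ext fun y => by
    change (1 • f).eval y = f.eval y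
    simp [smul_eval]
  mul_smul a b f := LinearMap.ext fun y => by
    change ((a * b) • f).eval y = (a • b • f).eval y
    simp [smul_eval, mul_assoc]
  smul_zero a := rfl
  smul_add a f g := rfl
  add_smul a b f := LinearMap.ext fun y => by
    change ((a + b) • f).eval y = (a • f + b • f).eval y
    rw [add_eval, smul_eval, smul_eval, smul_eval, ← map_add]
    congr 1
    ext i
    simp [mul_add]
  zero_smul f := LinearMap.ext fun y => by
    change ((0 : A) • f).eval y = (0 : DualModule K A E n).eval y
    rw [smul_eval, zero_eval, ← map_zero f.eval]
    congr 1
    ext i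
    simp

theorem eval_single (f : DualModule K A E n) (i : Fin n) (a : A) :
    f.eval (Pi.single i a) = (a • f).eval (Pi.single i 1) := by
  rw [smul_eval]
  congr 1
  ext j
  by_cases h : j = i
  · subst h
    simp
  · simp [h]

theorem algebraMap_smul_eval (c : K) (f : DualModule K A E n) (y : Fin n → A) :
    (algebraMap K A c • f).eval y = c • f.eval y := by
  rw [smul_eval, ← map_smul]
  congr 1
  ext i
  rw [← Algebra.commutes, Pi.smul_apply, Algebra.smul_def]

theorem finite (hE : ∀ {M : Type u} [AddCommGroup M] [Module K M], Module.Finite K M →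
    Module.Finite K (M →ₗ[K] E)) [Module.Finite K A] : Module.Finite A (DualModule K A E n) := by
  obtain ⟨s, hs⟩ := (hE (M := Fin n → A) inferInstance).fg_top
  refine ⟨⟨s, eq_top_iff.2 fun f _ => ?_⟩⟩
  have hf : f.eval ∈ Submodule.span K (s : Set ((Fin n → A) →ₗ[K] E)) := by
    rw [hs]; trivial
  change (f.eval : DualModule K A E n) ∈ _
  generalize f.eval = g at hf
  induction hf using Submodule.span_induction with
  | mem x hx => exact Submodule.subset_span hx
  | zero => exact zero_mem _
  | add x y _ _ hx hy => exact add_mem (S := Submodule A (DualModule K A E n)) hx hy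
  | smul c x _ hx =>
    have : (c • x : (Fin n → A) →ₗ[K] E) =
        (algebraMap K A c • (show DualModule K A E n from x) : DualModule K A E n) :=
      LinearMap.ext fun y => (algebraMap_smul_eval c (show DualModule K A E n from x) y).symm
    rw [this]
    exact Submodule.smul_mem _ _ hx

section Coinduced

variable {X : Type u} [AddCommGroup X] [Module A X] [Module K X] [IsScalarTower K A X]

/-- The linear map to the dual module defined by a family of functionals. -/
def coind (l : Fin n → (X →ₗ[K] E)) : X →ₗ[A] DualModule K A E n where
  toFun x :=
    { toFun := fun y => ∑ i, l i (y i • x)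
      map_add' := fun y z => by simp [add_smul, Finset.sum_add_distrib]
      map_smul' := fun c y => by simp [Finset.smul_sum] }
  map_add' x y := LinearMap.ext fun v => by
    change ∑ i, l i (v i • (x + y)) = ∑ i, l i (v i • x) + ∑ i, l i (v i • y)
    simp [Finset.sum_add_distrib]
  map_smul' a x := LinearMap.ext fun v => by
    change ∑ i, l i (v i • a • x) = ∑ i, l i ((v i * a) • x)
    simp [mul_smul]

theorem coind_eval (l : Fin n → (X →ₗ[K] E)) (x : X) (y : Fin n → A) :
    (coind l x).eval y = ∑ i, l i (y i • x) := rfl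

theorem coind_eval_single (l : Fin n → (X →ₗ[K] E)) (x : X) (i : Fin n) (a : A) :
    (coind l x).eval (Pi.single i a) = l i (a • x) := by
  rw [coind_eval, Finset.sum_eq_single i]
  · simp
  · intro j _ hj
    simp [hj]
  · simp

end Coinduced

/-- The dual modules are injective. -/
theorem injective (hE : IsInjectiveCogenerator K E) :
    Module.Injective A (DualModule K A E n) where
  out X Y _ _ _ _ f hf g := by
    let : Module K X := Module.compHom X (algebraMap K A)
    let : Module K Y := Module.compHom Y (algebraMap K A)
    have hX : IsScalarTower K A X := ⟨fun c a x => by rw [Algebra.smul_def, mul_smul]; rfl⟩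
    have hY : IsScalarTower K A Y := ⟨fun c a x => by rw [Algebra.smul_def, mul_smul]; rfl⟩
    let f' : X →ₗ[K] Y := f.restrictScalars K
    -- An `A`-linear map to `D(Aⁿ)` amounts to `n` functionals, so it suffices to extend these.
    let l : Fin n → (X →ₗ[K] E) := fun i =>
      { toFun := fun x => (g x).eval (Pi.single i 1)
        map_add' := fun x y => by rw [map_add, add_eval]
        map_smul' := fun c x => by
          rw [← algebraMap_smul A c x, map_smul, algebraMap_smul_eval, RingHom.id_apply] }
    have hl : ∀ i, ∃ l' : Y →ₗ[K] E, ∀ x, l' (f x) = l i x := fun i => by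
      obtain ⟨l', hl'⟩ := hE.exists_extension (LinearMap.range f')
        (l i ∘ₗ (LinearEquiv.ofInjective f' hf).symm.toLinearMap)
      refine ⟨l', fun x => ?_⟩
      have := hl' (LinearEquiv.ofInjective f' hf x)
      rwa [LinearMap.comp_apply, LinearEquiv.coe_coe, LinearEquiv.symm_apply_apply] at this
    choose l' hl' using hl
    refine ⟨coind l', fun x => eval_ext fun i a => ?_⟩
    rw [coind_eval_single, ← map_smul, hl', eval_single, ← map_smul]
    rfl

end DualModule

end DualModule

/-! ### The dualizing structure on finitely generated modules. -/

section Modules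

variable (K : Type u) {A : Type u} [CommRing K] [Ring A] [Algebra K A]

/-- Restriction of scalars to the base ring of an algebra. -/
@[reducible]
def FGModuleCat.moduleOfAlgebra (X : FGModuleCat.{u} A) : Module K X :=
  Module.restrictScalars K A X

attribute [local instance] FGModuleCat.moduleOfAlgebra

theorem FGModuleCat.isScalarTower_of_algebra (X : FGModuleCat.{u} A) : IsScalarTower K A X :=
  IsScalarTower.restrictScalars K A X

attribute [local instance] FGModuleCat.isScalarTower_of_algebra

namespace FGModuleCat

/-- The linear structure on the category of finitely generated modules over an algebra. -/
@[reducible]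
def linearOfAlgebra : Linear K (FGModuleCat.{u} A) where
  homModule X Y :=
    { smul := fun c f => ObjectProperty.homMk (ModuleCat.ofHom (c • f.hom.hom : X →ₗ[A] Y))
      one_smul := fun f => by ext x; exact one_smul K (f.hom.hom x)
      mul_smul := fun c d f => by ext x; exact mul_smul c d (f.hom.hom x)
      smul_zero := fun c => by ext x; exact smul_zero c
      smul_add := fun c f g => by ext x; exact smul_add c (f.hom.hom x) (g.hom.hom x)
      add_smul := fun c d f => by ext x; exact add_smul c d (f.hom.hom x)
      zero_smul := fun f => by ext x; exact zero_smul K (f.hom.hom x) }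
  smul_comp X Y Z c f g := by
    ext x
    exact (g.hom.hom.restrictScalars K).map_smul c (f.hom.hom x)
  comp_smul X Y Z f c g := rfl

attribute [local instance] linearOfAlgebra

variable {K}

theorem mono_of_injective {X Y : FGModuleCat.{u} A} (f : X ⟶ Y)
    (hf : Function.Injective f.hom.hom) : Mono f :=
  (forget₂ (FGModuleCat A) (ModuleCat A)).mono_of_mono_map ((ModuleCat.mono_iff_injective _).2 hf)

theorem epi_of_surjective {X Y : FGModuleCat.{u} A} (f : X ⟶ Y)
    (hf : Function.Surjective f.hom.hom) : Epi f :=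
  (forget₂ (FGModuleCat A) (ModuleCat A)).epi_of_epi_map ((ModuleCat.epi_iff_surjective _).2 hf)

theorem injective_of_mono [IsNoetherianRing A] {X Y : FGModuleCat.{u} A} (f : X ⟶ Y) [Mono f] :
    Function.Injective f.hom.hom :=
  (ModuleCat.mono_iff_injective ((forget₂ (FGModuleCat A) (ModuleCat A)).map f)).1 inferInstance

theorem surjective_of_epi [IsNoetherianRing A] {X Y : FGModuleCat.{u} A} (f : X ⟶ Y) [Epi f] :
    Function.Surjective f.hom.hom :=
  (ModuleCat.epi_iff_surjective ((forget₂ (FGModuleCat A) (ModuleCat A)).map f)).1 inferInstance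

variable (K) in
theorem finite_of_algebra [Module.Finite K A] (X : FGModuleCat.{u} A) : Module.Finite K X :=
  Module.Finite.trans A X

variable (K) in
theorem finite_hom [IsNoetherianRing K] [Module.Finite K A] (X Y : FGModuleCat.{u} A) :
    Module.Finite K (X ⟶ Y) := by
  obtain ⟨m, p, hp⟩ := Module.Finite.exists_fin' A X
  have := finite_of_algebra K Y
  let ev : (X ⟶ Y) →ₗ[K] (Fin m → Y) :=
    { toFun := fun f i => f.hom.hom (p (Pi.single i 1))
      map_add' := fun f g => rfl
      map_smul' := fun c f => rfl }
  refine Module.Finite.of_injective ev fun f g h => ?_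
  ext x
  obtain ⟨v, rfl⟩ := hp x
  have : f.hom.hom ∘ₗ p = g.hom.hom ∘ₗ p := by
    ext i
    exact congr_fun h i
  exact LinearMap.congr_fun this v

variable (K) in
/-- The morphisms from a free module given by families of elements. -/
def ofFamily {n : ℕ} {X : FGModuleCat.{u} A} : (Fin n → X) →ₗ[K] (of A (Fin n → A) ⟶ X) where
  toFun x := ObjectProperty.homMk (ModuleCat.ofHom (Fintype.linearCombination A x))
  map_add' x y := hom_ext (LinearMap.ext fun v => by
    change ∑ i, v i • (x i + y i) = ∑ i, v i • x i + ∑ i, v i • y i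
    simp only [smul_add, Finset.sum_add_distrib])
  map_smul' c x := hom_ext (LinearMap.ext fun v => by
    change ∑ i, v i • c • x i = c • ∑ i, v i • x i
    simp only [Finset.smul_sum, smul_comm c])

theorem ofFamily_apply_single {n : ℕ} {X : FGModuleCat.{u} A} (x : Fin n → X) (i : Fin n) (a : A) :
    (ofFamily K x).hom.hom (Pi.single i a) = a • x i :=
  Fintype.linearCombination_apply_single A x i a

variable (K) in
theorem eq_ofFamily {n : ℕ} {X : FGModuleCat.{u} A} (r : of A (Fin n → A) ⟶ X) :
    r = ofFamily K fun i => r.hom.hom (Pi.single i 1) := by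
  refine hom_ext (LinearMap.pi_ext fun i a => ?_)
  refine (?_ : r.hom.hom (Pi.single i a) = _).trans (ofFamily_apply_single _ i a).symm
  rw [← map_smul]
  congr 1
  rw [← Pi.single_smul, smul_eq_mul, mul_one]

variable {E : Type u} [AddCommGroup E] [Module K E]

theorem finite_dual [IsArtinianRing K]
    (hE' : ∀ (T : Type u) [AddCommGroup T] [Module K T] [IsSimpleModule K T],
      Module.length K (T →ₗ[K] E) ≤ 1) {M : Type u} [AddCommGroup M] [Module K M]
    (hM : Module.Finite K M) : Module.Finite K (M →ₗ[K] E) := by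
  have h : IsFiniteLength K M := ((IsArtinianRing.tfae K M).out 0 3).1 hM
  refine ((IsArtinianRing.tfae K _).out 0 3).2 (Module.length_ne_top_iff.1 ?_)
  exact ne_top_of_le_ne_top (Module.length_ne_top_iff.2 h) (length_dual_le hE' h)

variable (K E) in
/-- The pairing defining the Nakayama functor on free modules. -/
def dualPairing (n : ℕ) [Module.Finite A (DualModule K A E n)] :
    (of A (Fin n → A) ⟶ of A (DualModule K A E n)) →ₗ[K] E where
  toFun h := ∑ i, DualModule.eval (h.hom.hom (Pi.single i 1)) (Pi.single i 1)
  map_add' f g := by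
    rw [← Finset.sum_add_distrib]
    rfl
  map_smul' c f := by
    rw [RingHom.id_apply, Finset.smul_sum]
    exact Finset.sum_congr rfl fun i _ => DualModule.algebraMap_smul_eval c _ _

theorem dualPairing_ofFamily_comp {n : ℕ} [Module.Finite A (DualModule K A E n)]
    {X : FGModuleCat.{u} A} (x : Fin n → X) (b : X ⟶ of A (DualModule K A E n)) :
    dualPairing K E n (ofFamily K x ≫ b) =
      ∑ j, DualModule.eval (b.hom.hom (x j)) (Pi.single j 1) := by
  change ∑ j, DualModule.eval (b.hom.hom ((ofFamily K x).hom.hom (Pi.single j 1)))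
    (Pi.single j 1) = _
  refine Finset.sum_congr rfl fun j _ => ?_
  have h := ofFamily_apply_single (K := K) x j 1
  rw [one_smul] at h
  exact congr_arg (fun y => DualModule.eval (b.hom.hom y) (Pi.single j 1)) h

/-- Both `Hom_A(X, D(Aⁿ))` and the dual of `Hom_A(Aⁿ, X)` are `Hom_K(X, E)ⁿ`; the remaining half
follows from reflexivity. -/
theorem exists_nakayamaPair [IsArtinianRing K] [Module.Finite K A]
    (hE : IsInjectiveCogenerator K E)
    (hE' : ∀ (T : Type u) [AddCommGroup T] [Module K T] [IsSimpleModule K T],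
      Module.length K (T →ₗ[K] E) ≤ 1) (n : ℕ) [Module.Finite A (DualModule K A E n)] :
    Nonempty (NakayamaPair K E (of A (Fin n → A)) (of A (DualModule K A E n))) := by
  refine NakayamaPair.exists_of_reflexive hE (dualPairing K E n) (fun X l => ?_)
    (fun X b b' h => ?_) fun X => exists_eq_eval hE hE' ?_
  · let s : Fin n → (X →ₗ[K] E) := fun i => l ∘ₗ ofFamily K ∘ₗ LinearMap.single K (fun _ => X) i
    refine ⟨ObjectProperty.homMk (ModuleCat.ofHom (DualModule.coind s)), fun r => ?_⟩
    have key : dualPairing K E n (r ≫ ObjectProperty.homMk (ModuleCat.ofHom (DualModule.coind s))) =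
        ∑ i, (DualModule.coind s (r.hom.hom (Pi.single i 1))).eval (Pi.single i 1) := rfl
    simp_rw [key, DualModule.coind_eval_single, one_smul]
    change _ = ∑ i, l (ofFamily K (Pi.single i (r.hom.hom (Pi.single i 1))))
    rw [← map_sum, ← map_sum, Finset.univ_sum_single fun i => r.hom.hom (Pi.single i 1),
      ← eq_ofFamily]
  · refine hom_ext (LinearMap.ext fun x => DualModule.eval_ext fun i a => ?_)
    have key : ∀ b : X ⟶ of A (DualModule K A E n),
        dualPairing K E n (ofFamily K (Pi.single i (a • x)) ≫ b) =
          (b.hom.hom x).eval (Pi.single i a) := fun b => by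
      rw [dualPairing_ofFamily_comp, Finset.sum_eq_single i, Pi.single_eq_same, map_smul,
        ← DualModule.eval_single]
      · intro j _ hj
        rw [Pi.single_eq_of_ne hj, map_zero, DualModule.zero_eval]
      · exact fun h => absurd (Finset.mem_univ i) h
    rw [← key, ← key, h]
  · exact ((IsArtinianRing.tfae K _).out 0 3).1 (finite_hom K _ X)

/-- Finitely many functionals generate the dual of `X`; an element killed by all of them is killed
by every functional. -/
theorem exists_injective_coind [IsArtinianRing K] [Module.Finite K A]
    (hE : IsInjectiveCogenerator K E)
    (hE' : ∀ (T : Type u) [AddCommGroup T] [Module K T] [IsSimpleModule K T],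
      Module.length K (T →ₗ[K] E) ≤ 1) (X : FGModuleCat.{u} A) :
    ∃ (n : ℕ) (f : X →ₗ[A] DualModule K A E n), Function.Injective f := by
  have := finite_dual hE' (finite_of_algebra K X)
  obtain ⟨n, p, hp⟩ := Module.Finite.exists_fin' K (X →ₗ[K] E)
  refine ⟨n, DualModule.coind fun i => p (Pi.single i 1),
    (injective_iff_map_eq_zero (DualModule.coind fun i => p (Pi.single i 1))).2 fun x hx => ?_⟩
  by_contra h
  obtain ⟨l, -, hl⟩ := hE.exists_ne_zero (⊥ : Submodule K X) h
  obtain ⟨c, rfl⟩ := hp l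
  refine hl ?_
  have h' : LinearMap.applyₗ x ∘ₗ p = 0 := by
    ext i
    have := DualModule.coind_eval_single (fun i => p (Pi.single i 1)) x i (1 : A)
    rw [hx, one_smul] at this
    exact this.symm
  exact LinearMap.congr_fun h' c

theorem isDualizing [IsArtinianRing K] [Module.Finite K A] [IsNoetherianRing A]
    (hE : IsInjectiveCogenerator K E)
    (hE' : ∀ (T : Type u) [AddCommGroup T] [Module K T] [IsSimpleModule K T],
      Module.length K (T →ₗ[K] E) ≤ 1) : IsDualizing K E (FGModuleCat.{u} A) where
  cogenerator := hE
  noetherian X Y :=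
    have := finite_hom K X Y
    inferInstance
  exists_epi X := by
    obtain ⟨n, p, hp⟩ := Module.Finite.exists_fin' A X
    have : Module.Finite A (DualModule K A E n) := DualModule.finite (finite_dual hE')
    exact ⟨of A (Fin n → A), _, ObjectProperty.homMk (ModuleCat.ofHom p), epi_of_surjective _ hp,
      exists_nakayamaPair hE hE' n⟩
  exists_mono X := by
    obtain ⟨n, f, hf⟩ := exists_injective_coind hE hE' X
    have : Module.Finite A (DualModule K A E n) := DualModule.finite (finite_dual hE')
    exact ⟨_, of A (DualModule K A E n), ObjectProperty.homMk (ModuleCat.ofHom f),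
      mono_of_injective _ hf, exists_nakayamaPair hE hE' n⟩

end FGModuleCat

namespace MorphismIdeal

variable {K}

open FGModuleCat

/-- Every module embeds in an injective `D(Aⁿ)`. Conversely, a monomorphism of the ideal starting at
an injective module splits, so the ideal contains the identity of that module. -/
theorem containsInjectives_iff_hasMonos [IsArtinianRing K] [Module.Finite K A] [IsNoetherianRing A]
    {E : Type u} [AddCommGroup E] [Module K E] (hE : IsInjectiveCogenerator K E)
    (hE' : ∀ (T : Type u) [AddCommGroup T] [Module K T] [IsSimpleModule K T],
      Module.length K (T →ₗ[K] E) ≤ 1) {I : MorphismIdeal (FGModuleCat.{u} A)} :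
    I.ContainsInjectives ↔ I.HasMonos := by
  constructor
  · intro h X
    obtain ⟨n, f, hf⟩ := exists_injective_coind hE hE' X
    have : Module.Finite A (DualModule K A E n) := DualModule.finite (finite_dual hE')
    refine ⟨of A (DualModule K A E n), ObjectProperty.homMk (ModuleCat.ofHom f),
      mono_of_injective _ hf, ?_⟩
    simpa using h X (of A (DualModule K A E n)) _ (ObjectProperty.homMk (ModuleCat.ofHom f)) (𝟙 _)
      (DualModule.injective hE)
  · intro h X Q Y a b hQ
    obtain ⟨J, j, hj, hjI⟩ := h Q
    obtain ⟨r, hr⟩ := hQ.out j.hom.hom (injective_of_mono j) LinearMap.id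
    have hr' : j ≫ ObjectProperty.homMk (ModuleCat.ofHom r) = 𝟙 Q :=
      hom_ext (LinearMap.ext hr)
    have := I.comp_mem a j (ObjectProperty.homMk (ModuleCat.ofHom r) ≫ b) hjI
    rwa [← Category.assoc j, hr', Category.id_comp] at this

theorem containsProjectives_iff_hasEpis [IsNoetherianRing A]
    {I : MorphismIdeal (FGModuleCat.{u} A)} : I.ContainsProjectives ↔ I.HasEpis := by
  constructor
  · intro h X
    obtain ⟨n, p, hp⟩ := Module.Finite.exists_fin' A X
    refine ⟨of A (Fin n → A), ObjectProperty.homMk (ModuleCat.ofHom p), epi_of_surjective _ hp, ?_⟩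
    simpa using h (of A (Fin n → A)) (of A (Fin n → A)) X (𝟙 _)
      (ObjectProperty.homMk (ModuleCat.ofHom p)) (inferInstanceAs (Module.Projective A (Fin n → A)))
  · intro h X Q Y a b hQ
    obtain ⟨P, p, hp, hpI⟩ := h Q
    obtain ⟨s, hs⟩ := Module.projective_lifting_property p.hom.hom LinearMap.id
      (surjective_of_epi p)
    have hs' : (ObjectProperty.homMk (ModuleCat.ofHom s) : Q ⟶ P) ≫ p = 𝟙 Q := hom_ext hs
    have := I.comp_mem (a ≫ ObjectProperty.homMk (ModuleCat.ofHom s)) p b hpI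
    rwa [← Category.assoc _ p, Category.assoc a, hs', Category.comp_id] at this

end MorphismIdeal

end Modules

theorem corollary4p8 (k : Type w) (A : Type u) [CommRing k] [IsArtinianRing k] [Ring A]
    [Algebra k A] [Module.Finite k A] :
    ∃ (Φ : ExactStructure (FGModuleCat.{u} A) ≃
        {I : MorphismIdeal (FGModuleCat.{u} A) // I.IsFpIdempotent ∧ I.ContainsInjectives})
      (Ψ : ExactStructure (FGModuleCat.{u} A) ≃
        {P : MorphismIdeal (FGModuleCat.{u} A) // P.IsFpIdempotent ∧ P.ContainsProjectives}),
      (∀ E, (Φ E).1 = E.injectivityIdeal) ∧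
      (∀ E, (Ψ E).1 = E.projectivityIdeal) ∧
      (∀ I, (Φ.symm I).exact = I.1.leftExact) ∧
      (∀ P, (Ψ.symm P).exact = P.1.rightExact) := by
  -- The base ring is replaced by the centre of `A`: it is again artinian with `A` finite over it,
  -- and it lies in the universe of `A`, as the duality requires.
  let K := Subalgebra.center k A
  have hKf : Module.Finite k K := Module.Finite.of_injective K.val.toLinearMap Subtype.val_injective
  have : IsArtinianRing K := IsArtinianRing.of_finite k K
  let _ : Algebra K A :=
    { algebraMap := K.val.toRingHom
      commutes' := fun c x => (Subalgebra.mem_center_iff.1 c.2 x).symm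
      smul_def' := fun _ _ => rfl }
  have : Module.Finite K A := Module.Finite.of_restrictScalars_finite k K A
  have : IsNoetherianRing A := IsNoetherianRing.of_finite k A
  obtain ⟨E, _, _, hE, hE'⟩ := exists_injectiveCogenerator K
  let _ : Linear K (FGModuleCat.{u} A) := FGModuleCat.linearOfAlgebra K
  have hC : IsDualizing K E (FGModuleCat.{u} A) := FGModuleCat.isDualizing hE hE'
  refine ⟨hC.injectivityEquiv.trans (Equiv.subtypeEquivRight fun I =>
      and_congr MorphismIdeal.isFpIdempotent_iff_isSaturated.symm
        (MorphismIdeal.containsInjectives_iff_hasMonos hE hE').symm),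
    hC.projectivityEquiv.trans (Equiv.subtypeEquivRight fun I =>
      and_congr MorphismIdeal.isFpIdempotent_iff_isSaturated.symm
        MorphismIdeal.containsProjectives_iff_hasEpis.symm),
    hC.injectivityEquiv_apply, hC.projectivityEquiv_apply,
    fun I => hC.injectivityEquiv_symm_exact _, fun I => hC.projectivityEquiv_symm_exact _⟩
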